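/- **Setting.** Let $D_m$ be the set of càdlàg paths $x:[0,\infty)\to\mathbb R^m$, with $x(0-):=x(0)$, $\Delta x(t):=x(t)-x(t-)$, $x_t:=x(\cdot\wedge t)$, and $x_{t-}:=x$ on $[0,t)$, $x_{t-}:=x(t-)$ on $[t,\infty)$. Let $\pi=(\pi_n)_{n\ge1}$ be a sequence of finite partitions $0=t^n_0<\dots<t^n_{k_n}$ with $t^n_{k_n}\to\infty$ and mesh vanishing on compacts; put $t_{k_n+1}:=t_{k_n}$, $t'_n:=\max\{t_i\in\pi_n: t_i<t\}$ ($:=0$ if there is none) and $x^n:=\sum_{t_i\in\pi_n}x(t_{i+1})1_{[t_i,t_{i+1})}$. $Q^\pi_m$ is the set of $x\in D_m$ for which $q_n(t)=\sum_{\pi_n\ni t_i\le t}(x(t_{i+1})-x(t_i))(x(t_{i+1})-x(t_i))'$ converges in the Skorokhod ($J_1$) topology to a càdlàg limit $[x]$; its continuous part is $[x_i,x_j]^c(t):=[x_i,x_j](t)-\sum_{s\le t}\Delta x_i(s)\Delta x_j(s)$. A non-empty $\Omega\subset D_m$ is *generic* if (i) for all $x\in\Omega$ and $T>0$, $(x^n)_T\in\Omega$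 for all large $n$; (ii) for all $x\in\Omega$ and $t\ge0$ there is a convex neighbourhood $\mathcal U$ of $0$ with $-\Delta x(t)\in\mathcal U$ and $x_t+e1_{[t,\infty)}\in\Omega$ for all $e\in\mathcal U$. Its domain is $\Lambda=\{(t,x_t):t\ge0,\ x\in\Omega\}$. A functional $F:\Lambda\to\mathbb R$ is *left-continuous* if for all $x\in\Omega$, $t\ge0$: $F(s,x_{s-})\to F(t,x_{t-})$ as $s\to t$, $s\le t$; $F(s,x_s)\to F(t,x_{t-})$ as $s\uparrow t$, $s<t$; and, for every sequence $t_n\to t$, $F(t_n,x^n_{t_n-})\to F(t,x_{t-})$ if $t_n\le t_n'$ for all $n$, and $F(t_n,x^n_{t_n})\to F(t,x_{t-})$ if $t_n<t'_n$ for all $n$. It is *right-continuous* if for all $x\in\Omega$, $t\ge0$: $F(s,x_s)\to F(t,x_t)$ as $s\to t$, $s\ge t$; $F(s,x_{s-})\to F(t,x_t)$ as $s\downarrow t$, $s>t$; and, for every sequence $t_n\to t$, $F(t_n,x^n_{t_n})\to F(t,x_t)$ if $t_n\ge t'_n$ for all $n$, and $F(t_n,x^n_{t_n-})\to F(t,x_t)$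 if $t_n>t'_n$ for all $n$. The *$\pi$-topology* on $\Lambda$ is the initial topology generated by the functionals that are both left- and right-continuous. Write $F_-(t,x_t):=F(t,x_{t-})$, $\mathcal DF(t,x_t):=\lim_{h\downarrow0}\frac{F(t+h,x_t)-F(t,x_t)}h$, $\nabla_xF(t,x_t):=$ gradient at $e=0$ of $e\mapsto F(t,x_t+e1_{[t,\infty)})$, and $\nabla_x^2F:=\nabla_x(\nabla_xF)$. $F$ is *locally bounded* if for all $x\in\Omega$, $T\ge0$ there are $n_0,K$ with $|F(t,x^n_t)|\le K$ for all $n\ge n_0$, $t\le T$. For each $t\ge 0$ and each path $x$ with $x_t\in\Omega$ choose a convex neighbourhood $\mathcal U_{t-}(x)$ of $0$ which contains $\Delta x(t)$ and satisfies $x_{t-}+e1_{[t,\infty)}\in\Omega$ for all $e\in\mathcal U_{t-}(x)$ (such neighbourhoods exist by (ii)). $F$ *admits a modulus of vertical continuity* if, for some such choice, for all $x\in\Omega$, $T\ge0$, $r>0$ there is an increasing $\omega:[0,\infty)\to[0,\infty)$ with $\omega(0+)=0$ such that, for all large $n$, all $t\le T$ and all $a,b\in\mathcal U_{t-}(x^n)\cap\overline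 B_r(0)$, $$|F(t,x^n_{t-}+a1_{[t,\infty)})-F(t,x^n_{t-}+b1_{[t,\infty)})|\le\omega(|a-b|).$$ $C^{1,2}(\Lambda)$ is the set of functionals $F:\Lambda\to\mathbb R$, continuous for the $\pi$-topology, such that $\mathcal DF,\nabla_xF,\nabla^2_xF$ exist on $\Lambda$; $\mathcal DF$ is right-continuous and locally bounded; $(\nabla_xF)_-$ is left-continuous; $(\nabla_x^2F)_-$ is left-continuous and locally bounded; and $\nabla_x^2F$ admits a modulus of vertical continuity (for vector- and matrix-valued functionals: componentwise). **Theorem (change of variable formula).** Let $\Omega$ be generic, $x\in\Omega\cap Q^\pi_m$, $F\in C^{1,2}(\Lambda)$ and $T\ge0$. Then the limit $$\int_0^T\nabla_xF(t,x_{t-})\,dx:=\lim_{n\to\infty}\sum_{\pi_n\ni t_i\le T}\nabla_xF(t_i,x^n_{t_i-})\cdot(x(t_{i+1})-x(t_i))$$ exists, and $$F(T,x_T)=F(0,x_0)+\int_0^T\mathcal DF(t,x_t)\,dt+\int_0^T\nabla_xF(t,x_{t-})\,dx+\frac12\int_0^T\nabla_x^2F(t,x_{t-})\,d[x]^c+\sum_{t\le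 T}\bigl(\Delta F(t,x_t)-\nabla_xF(t,x_{t-})\cdot\Delta x(t)\bigr),$$ where $\Delta F(t,x_t):=F(t,x_t)-F(t,x_{t-})$, the series converges absolutely, and $\int_0^T f\,dg:=\sum_{i,j}\int_{(0,T]}f_{ij}\,dg_{ij}$ is a Lebesgue–Stieltjes integral. In particular $t\mapsto\mathcal DF(t,x_t)$ is Lebesgue integrable on $[0,T]$, the series $\sum_{s\le T}\Delta x_i(s)\Delta x_j(s)$ defining $[x]^c$ converge absolutely, and the functions $[x_i,x_j]^c$ are of bounded variation on $[0,T]$ with $t\mapsto(\nabla_x^2F(t,x_{t-}))_{ij}$ integrable against them. No condition relating $\pi$ to the jump times of $x$ is assumed. -/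

import Mathlib

open Filter Topology MeasureTheory
open scoped NNReal

noncomputable section

namespace CausalCalculus

/-- Trajectories `x : [0,∞) → ℝᵐ`, where `ℝᵐ` carries the Euclidean norm. -/
abbrev Traj (m : ℕ) : Type := ℝ≥0 → EuclideanSpace ℝ (Fin m)

/-- Functionals of a time and a trajectory. A functional on a domain `Λ` of stopped paths is
represented by such an `F`, of which only the values at points of `Λ` are ever used. -/
abbrev Functional (m : ℕ) (V : Type) : Type := ℝ≥0 → Traj m → V

/-! ### Càdlàg paths and stopping -/

/-- Right-continuous with left limits (the condition on left limits is void at time `0`). -/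
def IsCadlag {V : Type} [TopologicalSpace V] (x : ℝ≥0 → V) : Prop :=
  ∀ t, ContinuousWithinAt x (Set.Ici t) t ∧ ∃ l, Tendsto x (𝓝[<] t) (𝓝 l)

/-- The jump `Δx(t) = x(t) - x(t-)`. Mathlib's `Function.leftLim` satisfies the convention
`x(0-) = x(0)`. -/
def jump {m : ℕ} (x : Traj m) (t : ℝ≥0) : EuclideanSpace ℝ (Fin m) :=
  x t - Function.leftLim x t

/-- The path `x_t` stopped at `t`. -/
def stopAt {m : ℕ} (x : Traj m) (t : ℝ≥0) : Traj m := fun s => x (min s t)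

/-- The path `x_{t-}` stopped just before `t`: it equals `x` on `[0,t)` and `x(t-)` on `[t,∞)`. -/
def stopLeft {m : ℕ} (x : Traj m) (t : ℝ≥0) : Traj m :=
  fun s => if s < t then x s else Function.leftLim x t

/-- The vertically perturbed path `x + e 1_{[t,∞)}`. -/
def bump {m : ℕ} (x : Traj m) (t : ℝ≥0) (e : EuclideanSpace ℝ (Fin m)) : Traj m :=
  fun s => x s + if t ≤ s then e else 0

/-! ### Partitions -/

/-- The point following `t` in the finite set `P`, i.e. `min {u ∈ P | t < u}`, with the convention
that it is the last point of `P` if there is no such `u`. -/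
def next (P : Finset ℝ≥0) (t : ℝ≥0) : ℝ≥0 :=
  if h : (P.filter (fun u => t < u)).Nonempty then (P.filter (fun u => t < u)).min' h
  else P.sup id

/-- The point preceding `t` in the finite set `P`, i.e. `max {u ∈ P | u < t}`, with the convention
`max ∅ = 0`. -/
def prev (P : Finset ℝ≥0) (t : ℝ≥0) : ℝ≥0 := (P.filter (fun u => u < t)).sup id

/-- A sequence of finite partitions of `[0,∞)`, given by their sets of points, which start at `0`,
whose last points tend to infinity, and whose mesh vanishes on compacts. -/
structure PartitionSeq where
  pts : ℕ → Finset ℝ≥0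
  zero_mem : ∀ n, 0 ∈ pts n
  tendsto_last : Tendsto (fun n => (pts n).sup id) atTop atTop
  mesh : ∀ T : ℝ≥0, ∀ ε : ℝ≥0, 0 < ε →
    ∀ᶠ n in atTop, ∀ t ∈ pts n, t ≤ T → next (pts n) t < t + ε

/-- The piecewise constant approximation `xⁿ = ∑_{tᵢ ∈ P} x(tᵢ₊₁) 1_{[tᵢ, tᵢ₊₁)}`. -/
def approx {m : ℕ} (P : Finset ℝ≥0) (x : Traj m) : Traj m :=
  fun s => ∑ t ∈ P, (Set.Ico t (next P t)).indicator (fun _ => x (next P t)) s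

/-! ### Quadratic variation along a sequence of partitions -/

/-- Convergence in the Skorokhod (J₁) topology on `[0,∞)`: there are time changes `lam n`
(increasing bijections of `[0,∞)`) converging uniformly to the identity such that `a n ∘ lam n`
converges to `b` uniformly on compacts. -/
def SkorokhodTendsto {V : Type} [UniformSpace V] (a : ℕ → ℝ≥0 → V) (b : ℝ≥0 → V) : Prop :=
  ∃ lam : ℕ → ℝ≥0 ≃o ℝ≥0,
    TendstoUniformly (fun n s => lam n s) id atTop ∧
    ∀ N : ℝ≥0, TendstoUniformlyOn (fun n s => a n (lam n s)) b atTop (Set.Iic N)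

/-- `q(t) = ∑_{tᵢ ∈ P, tᵢ ≤ t} (x(tᵢ₊₁) - x(tᵢ)) (x(tᵢ₊₁) - x(tᵢ))'`. -/
def qvSum {m : ℕ} (P : Finset ℝ≥0) (x : Traj m) (t : ℝ≥0) : Matrix (Fin m) (Fin m) ℝ :=
  Matrix.of fun i j => ∑ u ∈ P.filter (fun u => u ≤ t),
    (x (next P u) - x u) i * (x (next P u) - x u) j

/-- The càdlàg matrix-valued path `q` is the quadratic variation of `x` along `π`. -/
def HasQuadVar {m : ℕ} (π : PartitionSeq) (x : Traj m)
    (q : ℝ≥0 → Matrix (Fin m) (Fin m) ℝ) : Prop :=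
  IsCadlag q ∧ SkorokhodTendsto (fun n => qvSum (π.pts n) x) q

/-- The set of càdlàg paths with finite quadratic variation along `π`. -/
def finiteQV (m : ℕ) (π : PartitionSeq) : Set (Traj m) :=
  {x | IsCadlag x ∧ ∃ q, HasQuadVar π x q}

open scoped Classical in
/-- The quadratic variation `[x]` of `x` along `π` (`0` if `x` has none). -/
def quadVar {m : ℕ} (π : PartitionSeq) (x : Traj m) : ℝ≥0 → Matrix (Fin m) (Fin m) ℝ :=
  if h : ∃ q, HasQuadVar π x q then h.choose else 0

/-- The continuous part `[x]ᶜ` of the quadratic variation: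
`[xᵢ,xⱼ]ᶜ(t) = [xᵢ,xⱼ](t) - ∑_{s ≤ t} Δxᵢ(s) Δxⱼ(s)`. -/
def contQuadVar {m : ℕ} (π : PartitionSeq) (x : Traj m) (i j : Fin m) (t : ℝ≥0) : ℝ :=
  quadVar π x t i j - ∑' s : Set.Iic t, jump x s i * jump x s j

/-- `I` is the Lebesgue–Stieltjes integral `∫_{(0,T]} f dg`. Part of the assertion is that on
`[0,T]` the function `g - g(0)` is the difference of the distribution functions of two finite
measures (so `g` has bounded variation there), with respect to both of which `f` is integrable;
the value does not depend on the choice of the two measures. -/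
def HasStieltjesIntegral (f g : ℝ≥0 → ℝ) (T : ℝ≥0) (I : ℝ) : Prop :=
  ∃ μ ν : Measure ℝ≥0, IsFiniteMeasure μ ∧ IsFiniteMeasure ν ∧
    (∀ s ≤ T, g s - g 0 = μ.real (Set.Ioc 0 s) - ν.real (Set.Ioc 0 s)) ∧
    IntegrableOn f (Set.Ioc 0 T) μ ∧ IntegrableOn f (Set.Ioc 0 T) ν ∧
    I = (∫ s in Set.Ioc 0 T, f s ∂μ) - ∫ s in Set.Ioc 0 T, f s ∂ν

/-! ### Generic sets of paths, domains and the `π`-topology -/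

/-- Generic sets of càdlàg paths: stable under piecewise constant approximation along `π` and
under vertical perturbations. -/
structure IsGeneric {m : ℕ} (π : PartitionSeq) (Ω : Set (Traj m)) : Prop where
  nonempty : Ω.Nonempty
  cadlag : ∀ x ∈ Ω, IsCadlag x
  approx_mem : ∀ x ∈ Ω, ∀ T : ℝ≥0, 0 < T →
    ∀ᶠ n in atTop, stopAt (approx (π.pts n) x) T ∈ Ω
  bump_mem : ∀ x ∈ Ω, ∀ t : ℝ≥0, ∃ U : Set (EuclideanSpace ℝ (Fin m)),
    Convex ℝ U ∧ U ∈ 𝓝 0 ∧ -jump x t ∈ U ∧ ∀ e ∈ U, bump (stopAt x t) t e ∈ Ω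

/-- The domain `Λ = {(t, x_t) | t ≥ 0, x ∈ Ω}` of stopped paths. -/
def domain {m : ℕ} (Ω : Set (Traj m)) : Set (ℝ≥0 × Traj m) :=
  {z | ∃ t : ℝ≥0, ∃ x ∈ Ω, z = (t, stopAt x t)}

/-- Left-continuous functionals. -/
structure LeftCts {m : ℕ} (π : PartitionSeq) (Ω : Set (Traj m)) (F : Functional m ℝ) : Prop where
  a : ∀ x ∈ Ω, ∀ t, Tendsto (fun s => F s (stopLeft x s)) (𝓝[≤] t) (𝓝 (F t (stopLeft x t)))
  b : ∀ x ∈ Ω, ∀ t, Tendsto (fun s => F s (stopAt x s)) (𝓝[<] t) (𝓝 (F t (stopLeft x t)))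
  c : ∀ x ∈ Ω, ∀ t, ∀ s : ℕ → ℝ≥0, Tendsto s atTop (𝓝 t) → (∀ n, s n ≤ prev (π.pts n) t) →
    Tendsto (fun n => F (s n) (stopLeft (approx (π.pts n) x) (s n))) atTop (𝓝 (F t (stopLeft x t)))
  d : ∀ x ∈ Ω, ∀ t, ∀ s : ℕ → ℝ≥0, Tendsto s atTop (𝓝 t) → (∀ n, s n < prev (π.pts n) t) →
    Tendsto (fun n => F (s n) (stopAt (approx (π.pts n) x) (s n))) atTop (𝓝 (F t (stopLeft x t)))

/-- Right-continuous functionals. -/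
structure RightCts {m : ℕ} (π : PartitionSeq) (Ω : Set (Traj m)) (F : Functional m ℝ) : Prop where
  a : ∀ x ∈ Ω, ∀ t, Tendsto (fun s => F s (stopAt x s)) (𝓝[≥] t) (𝓝 (F t (stopAt x t)))
  b : ∀ x ∈ Ω, ∀ t, Tendsto (fun s => F s (stopLeft x s)) (𝓝[>] t) (𝓝 (F t (stopAt x t)))
  c : ∀ x ∈ Ω, ∀ t, ∀ s : ℕ → ℝ≥0, Tendsto s atTop (𝓝 t) → (∀ n, prev (π.pts n) t ≤ s n) →
    Tendsto (fun n => F (s n) (stopAt (approx (π.pts n) x) (s n))) atTop (𝓝 (F t (stopAt x t)))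
  d : ∀ x ∈ Ω, ∀ t, ∀ s : ℕ → ℝ≥0, Tendsto s atTop (𝓝 t) → (∀ n, prev (π.pts n) t < s n) →
    Tendsto (fun n => F (s n) (stopLeft (approx (π.pts n) x) (s n))) atTop (𝓝 (F t (stopAt x t)))

/-- The real functions on the domain that are both left- and right-continuous functionals. -/
def regularFunctionals {m : ℕ} (π : PartitionSeq) (Ω : Set (Traj m)) : Set (domain Ω → ℝ) :=
  {f | ∃ F : Functional m ℝ, LeftCts π Ω F ∧ RightCts π Ω F ∧ ∀ z : domain Ω, f z = F z.1.1 z.1.2}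

/-- The `π`-topology: the initial topology on the domain generated by `regularFunctionals`. -/
@[reducible] def piTopology {m : ℕ} (π : PartitionSeq) (Ω : Set (Traj m)) : TopologicalSpace (domain Ω) :=
  ⨅ f ∈ regularFunctionals π Ω, TopologicalSpace.induced f inferInstance

/-- Functionals on the domain that are continuous for the `π`-topology. -/
def IsPiContinuous {m : ℕ} (π : PartitionSeq) (Ω : Set (Traj m)) (F : Functional m ℝ) : Prop :=
  Continuous[piTopology π Ω, inferInstance] (fun z : domain Ω => F z.1.1 z.1.2)

/-! ### Derivatives and smooth functionals -/

/-- The functional `F_-(t, x_t) = F(t, x_{t-})`. -/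
def minus {m : ℕ} {V : Type} (F : Functional m V) : Functional m V := fun t y => F t (stopLeft y t)

/-- `F` has horizontal derivative `l` at `(t, y)`. -/
def HasHorizDeriv {m : ℕ} (F : Functional m ℝ) (t : ℝ≥0) (y : Traj m) (l : ℝ) : Prop :=
  Tendsto (fun h : ℝ≥0 => (F (t + h) y - F t y) / (h : ℝ)) (𝓝[>] 0) (𝓝 l)

/-- The horizontal derivative `𝒟F`. -/
def horizDeriv {m : ℕ} (F : Functional m ℝ) : Functional m ℝ :=
  fun t y => limUnder (𝓝[>] (0 : ℝ≥0)) (fun h : ℝ≥0 => (F (t + h) y - F t y) / (h : ℝ))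

/-- `F` is vertically differentiable at `(t, y)`. -/
def VertDifferentiableAt {m : ℕ} (F : Functional m ℝ) (t : ℝ≥0) (y : Traj m) : Prop :=
  DifferentiableAt ℝ (fun e => F t (bump y t e)) 0

/-- The vertical derivative `∇ₓF`. -/
def vertGrad {m : ℕ} (F : Functional m ℝ) : Functional m (EuclideanSpace ℝ (Fin m)) :=
  fun t y => gradient (fun e => F t (bump y t e)) 0

/-- The second vertical derivative `∇ₓ²F`, with entries `∂ⱼ(∂ᵢF)`. -/
def vertHess {m : ℕ} (F : Functional m ℝ) : Functional m (Matrix (Fin m) (Fin m) ℝ) :=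
  fun t y => Matrix.of fun i j => vertGrad (fun s z => vertGrad F s z i) t y j

/-- Locally bounded functionals. -/
def LocallyBdd {m : ℕ} (π : PartitionSeq) (Ω : Set (Traj m)) (F : Functional m ℝ) : Prop :=
  ∀ x ∈ Ω, ∀ T : ℝ≥0, ∃ n₀ : ℕ, ∃ K : ℝ, ∀ n ≥ n₀, ∀ t ≤ T,
    |F t (stopAt (approx (π.pts n) x) t)| ≤ K

/-- `U` is a convex neighbourhood of `0` that contains `Δx(t)` and along which `x_{t-}` may be
perturbed vertically at `t` without leaving `Ω`. -/
def IsVertNbhd {m : ℕ} (Ω : Set (Traj m)) (t : ℝ≥0) (x : Traj m)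
    (U : Set (EuclideanSpace ℝ (Fin m))) : Prop :=
  Convex ℝ U ∧ U ∈ 𝓝 0 ∧ jump x t ∈ U ∧ ∀ e ∈ U, bump (stopLeft x t) t e ∈ Ω

/-- `F` admits a modulus of vertical continuity (with respect to some choice `U t x` of
neighbourhoods as in `IsVertNbhd`, defined as soon as the path `x` stopped at `t` is in `Ω`). -/
def HasVertModulus {m : ℕ} (π : PartitionSeq) (Ω : Set (Traj m)) (F : Functional m ℝ) : Prop :=
  ∃ U : ℝ≥0 → Traj m → Set (EuclideanSpace ℝ (Fin m)),
    (∀ t x, stopAt x t ∈ Ω → IsVertNbhd Ω t x (U t x)) ∧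
    ∀ x ∈ Ω, ∀ T : ℝ≥0, ∀ r : ℝ, 0 < r →
      ∃ ω : ℝ≥0 → ℝ≥0, Monotone ω ∧ Tendsto ω (𝓝[>] 0) (𝓝 0) ∧
        ∀ᶠ n in atTop, ∀ t ≤ T,
          ∀ a ∈ U t (approx (π.pts n) x) ∩ Metric.closedBall 0 r,
          ∀ b ∈ U t (approx (π.pts n) x) ∩ Metric.closedBall 0 r,
            |F t (bump (stopLeft (approx (π.pts n) x) t) t a) -
              F t (bump (stopLeft (approx (π.pts n) x) t) t b)| ≤ ω ‖a - b‖₊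

/-- The class `C^{1,2}(Λ)`; conditions on vector- and matrix-valued functionals are imposed on
their components. -/
structure IsC12 {m : ℕ} (π : PartitionSeq) (Ω : Set (Traj m)) (F : Functional m ℝ) : Prop where
  continuous : IsPiContinuous π Ω F
  horizDiff : ∀ x ∈ Ω, ∀ t, ∃ l, HasHorizDeriv F t (stopAt x t) l
  vertDiff : ∀ x ∈ Ω, ∀ t, VertDifferentiableAt F t (stopAt x t)
  vertDiff₂ : ∀ i, ∀ x ∈ Ω, ∀ t, VertDifferentiableAt (fun s z => vertGrad F s z i) t (stopAt x t)
  horiz_rightCts : RightCts π Ω (horizDeriv F)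
  horiz_locallyBdd : LocallyBdd π Ω (horizDeriv F)
  grad_leftCts : ∀ i, LeftCts π Ω (minus fun t y => vertGrad F t y i)
  hess_leftCts : ∀ i j, LeftCts π Ω (minus fun t y => vertHess F t y i j)
  hess_locallyBdd : ∀ i j, LocallyBdd π Ω (minus fun t y => vertHess F t y i j)
  hess_modulus : ∀ i j, HasVertModulus π Ω (fun t y => vertHess F t y i j)

/-! ### The terms of the change of variable formula -/

/-- The left Riemann sum
`∑_{tᵢ ∈ P, tᵢ ≤ T} ∇ₓF(tᵢ, xⁿ_{tᵢ-}) · (x(tᵢ₊₁) - x(tᵢ))`, where `xⁿ` is the approximation of `x`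
along `P`. -/
def riemannSum {m : ℕ} (P : Finset ℝ≥0) (F : Functional m ℝ) (x : Traj m) (T : ℝ≥0) : ℝ :=
  ∑ t ∈ P.filter (fun t => t ≤ T),
    inner ℝ (vertGrad F t (stopLeft (approx P x) t)) (x (next P t) - x t)

/-- The jump term `ΔF(t, x_t) - ∇ₓF(t, x_{t-}) · Δx(t)`, where
`ΔF(t, x_t) = F(t, x_t) - F(t, x_{t-})`. -/
def jumpTerm {m : ℕ} (F : Functional m ℝ) (x : Traj m) (t : ℝ≥0) : ℝ :=
  (F t (stopAt x t) - F t (stopLeft x t)) - inner ℝ (vertGrad F t (stopLeft x t)) (jump x t)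

end CausalCalculus

end

open CausalCalculus

namespace CausalCalculus

variable {m : ℕ}

/-! ### Partition points -/

/-! Along the approximation xⁿ the formula is elementary. Between partition points xⁿ is constant,
so F changes there by the time integral of its horizontal derivative; at a partition point t > 0 the
path jumps by the increment δ of x over the interval starting at t
(`eq_integral_horizDeriv_add_sum`, `jump_approx`). A second-order expansion of these vertical
increments (`abs_vertical_taylor_le`) splits their sum into the Riemann sum, half the sum of the
Hessian forms in δ, and a sum of remainders R|δ|². All terms except the Riemann sum are shown to
converge; hence the Riemann sum converges as well, and its limit can be read off
(`tendsto_riemannSum`).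

The second-order terms are sums ∑ fₙ(tᵢ) b(δᵢ) with a quadratic form b ≥ 0: |δ|² for the remainders,
polarized squares for the Hessian entries. Two facts make them converge. First, Skorokhod
convergence of the cumulative sums of b(δᵢ) to G yields convergence at every time. If G jumps at t,
the time change must eventually send t to the partition point t' preceding t, because no other
partition interval near t carries a non-negligible increment (`eventually_timeChange_eq_prev`).
Hence ΔG = b(Δx), whatever the position of the partitions relative to the jumps. Second, a weighted
sum is the integral over levels u of fₙ at the partition point where the cumulative sum crosses u.
For almost every u these points converge to the u-quantile t of G, and dominated convergence gives ∫
f dG (`tendsto_sum_weighted`).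

For the Hessian, left-continuity is enough: if u < G(t), the crossing points eventually lie at or
before t'; if u = G(t), two-sided convergence is needed, and it fails for only countably many t
(`ConvergesLeft.countable`). The ratio R is controlled by the modulus of vertical continuity, so it
vanishes in the limit where x is continuous, while at a jump it converges to the corresponding ratio
for x (`tendsto_sum_remainder`).

Finally the limiting integrals are split into their atoms at the jump times and the rest. At an
atom, R|Δx|² is the jump term minus half the Hessian form; the atoms of the Hessian integral
compensate that form, and what remains is the integral against [x]ᶜ (`hasSum_jumpTerm`). -/

lemma next_mem {P : Finset ℝ≥0} (h0 : P.Nonempty) (t : ℝ≥0) : next P t ∈ P := by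
  unfold next
  split_ifs with h
  · exact (Finset.mem_filter.1 (Finset.min'_mem _ h)).1
  · have := Finset.exists_mem_eq_sup P h0 id
    obtain ⟨u, hu, hu'⟩ := this
    rw [hu']; exact hu

lemma exists_gt_of_lt_sup {P : Finset ℝ≥0} {t : ℝ≥0} (h : t < P.sup id) : ∃ u ∈ P, t < u := by
  obtain ⟨u, hu, hu'⟩ := (Finset.lt_sup_iff (f := id) (s := P)).1 h
  exact ⟨u, hu, hu'⟩

lemma lt_next {P : Finset ℝ≥0} {t : ℝ≥0} (h : t < P.sup id) : t < next P t := by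
  obtain ⟨u, hu, hu'⟩ := exists_gt_of_lt_sup h
  have hne : (P.filter (fun u => t < u)).Nonempty := ⟨u, by simp [hu, hu']⟩
  rw [next, dif_pos hne]
  exact (Finset.mem_filter.1 (Finset.min'_mem _ hne)).2

lemma next_le {P : Finset ℝ≥0} {t u : ℝ≥0} (hu : u ∈ P) (h : t < u) : next P t ≤ u := by
  have hne : (P.filter (fun u => t < u)).Nonempty := ⟨u, by simp [hu, h]⟩
  rw [next, dif_pos hne]
  exact Finset.min'_le _ _ (by simp [hu, h])

lemma next_eq_sup {P : Finset ℝ≥0} {t : ℝ≥0} (h : P.sup id ≤ t) : next P t = P.sup id := by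
  rw [next, dif_neg]
  rintro ⟨u, hu⟩
  rw [Finset.mem_filter] at hu
  exact absurd (hu.2.trans_le (Finset.le_sup (f := id) hu.1)) (not_lt.2 h)

lemma le_next_of_mem {P : Finset ℝ≥0} {t : ℝ≥0} (ht : t ∈ P) : t ≤ next P t := by
  rcases lt_or_ge t (P.sup id) with h | h
  · exact (lt_next h).le
  · rw [next_eq_sup h]; exact Finset.le_sup (f := id) ht

lemma prev_mem {P : Finset ℝ≥0} (h0 : 0 ∈ P) (t : ℝ≥0) : prev P t ∈ P := by
  unfold prev
  rcases (P.filter (fun u => u < t)).eq_empty_or_nonempty with h | h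
  · rw [h]; simpa using h0
  · obtain ⟨u, hu, hu'⟩ := Finset.exists_mem_eq_sup _ h id
    rw [hu']; exact (Finset.mem_filter.1 hu).1

lemma le_prev {P : Finset ℝ≥0} {t u : ℝ≥0} (hu : u ∈ P) (h : u < t) : u ≤ prev P t :=
  Finset.le_sup (f := id) (by simp [hu, h])

lemma prev_lt {P : Finset ℝ≥0} {t : ℝ≥0} (ht : 0 < t) : prev P t < t := by
  unfold prev
  rw [Finset.sup_lt_iff (by simpa using ht)]
  intro u hu
  exact (Finset.mem_filter.1 hu).2

lemma prev_zero (P : Finset ℝ≥0) : prev P 0 = 0 := by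
  simp [prev]

lemma prev_le (P : Finset ℝ≥0) (t : ℝ≥0) : prev P t ≤ t := by
  rcases eq_or_ne t 0 with rfl | h
  · rw [prev_zero]
  · exact (prev_lt (pos_iff_ne_zero.2 h)).le

lemma le_next_prev {P : Finset ℝ≥0} {t : ℝ≥0} (h : t ≤ P.sup id) :
    t ≤ next P (prev P t) := by
  rcases eq_or_ne t 0 with rfl | h0
  · exact zero_le
  have hpos : 0 < t := pos_iff_ne_zero.2 h0
  by_contra! hlt
  have hlt' : prev P t < P.sup id := (prev_lt hpos).trans_le h
  have h1 : P.Nonempty := by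
    obtain ⟨u, hu, -⟩ := exists_gt_of_lt_sup hlt'
    exact ⟨u, hu⟩
  exact absurd (le_prev (next_mem h1 _) hlt) (not_le.2 (lt_next hlt'))

lemma eq_prev {P : Finset ℝ≥0} {s t : ℝ≥0} (hs : s ∈ P) (h : s < t) (h' : t ≤ next P s) :
    s = prev P t := by
  refine le_antisymm (le_prev hs h) ?_
  unfold prev
  refine Finset.sup_le fun u hu => ?_
  rw [Finset.mem_filter] at hu
  by_contra! hlt
  exact absurd (next_le hu.1 hlt) (not_le.2 (hu.2.trans_le h'))

/-- The partition interval to the right of `s` starts at the last partition point `≤ s`. -/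
lemma exists_cell {P : Finset ℝ≥0} (h0 : 0 ∈ P) (s : ℝ≥0) :
    ∃ t ∈ P, t ≤ s ∧ next P t = next P s ∧ ∀ u ∈ P, u ≤ s → u ≤ t := by
  have hne : (P.filter (fun u => u ≤ s)).Nonempty := ⟨0, by simp [h0]⟩
  refine ⟨(P.filter (fun u => u ≤ s)).max' hne, ?_, ?_, ?_, ?_⟩
  · exact (Finset.mem_filter.1 (Finset.max'_mem _ hne)).1
  · exact (Finset.mem_filter.1 (Finset.max'_mem _ hne)).2
  · set t := (P.filter (fun u => u ≤ s)).max' hne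
    have hts : t ≤ s := (Finset.mem_filter.1 (Finset.max'_mem _ hne)).2
    have hmax : ∀ u ∈ P, u ≤ s → u ≤ t := fun u hu hus => Finset.le_max' _ _ (by simp [hu, hus])
    have : P.filter (fun u => t < u) = P.filter (fun u => s < u) := by
      apply Finset.filter_congr
      intro u hu
      constructor
      · intro h; by_contra! h'; exact absurd (hmax u hu h') (not_le.2 h)
      · intro h; exact hts.trans_lt h
    unfold next
    simp only [this]
  · intro u hu hus; exact Finset.le_max' _ _ (by simp [hu, hus])

lemma approx_apply {P : Finset ℝ≥0} (h0 : 0 ∈ P) (x : Traj m) {s : ℝ≥0} (hs : s < P.sup id) :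
    approx P x s = x (next P s) := by
  obtain ⟨t, ht, hts, hn, hmax⟩ := exists_cell h0 s
  unfold approx
  rw [Finset.sum_eq_single_of_mem t ht, Set.indicator_of_mem, hn]
  · exact ⟨hts, hn ▸ lt_next hs⟩
  · intro u hu hut
    apply Set.indicator_of_notMem
    rintro ⟨h1, h2⟩
    have h3 : u < t := lt_of_le_of_ne (hmax u hu h1) hut
    exact absurd (h2.trans_le (next_le ht h3)) (not_lt.2 hts)

lemma next_eq_of_mem {P : Finset ℝ≥0} {s t : ℝ≥0} (ht : t ∈ P) (hs : prev P t ≤ s) (hst : s < t) :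
    next P s = t := by
  refine le_antisymm (next_le ht hst) ?_
  by_contra! h
  have h1 : s < P.sup id := hst.trans_le (Finset.le_sup (f := id) ht)
  exact absurd (le_prev (next_mem ⟨t, ht⟩ s) h) (not_le.2 (hs.trans_lt (lt_next h1)))

/-! ### Left limits, stopping and bumping -/

lemma leftLim_zero {V : Type} [TopologicalSpace V] (x : ℝ≥0 → V) : Function.leftLim x 0 = x 0 :=
  leftLim_eq_of_eq_bot x (by
    have : Set.Iio (0 : ℝ≥0) = ∅ := by ext; simp
    rw [this, nhdsWithin_empty])

lemma nhdsLT_neBot {t : ℝ≥0} (ht : 0 < t) : (𝓝[<] t).NeBot := by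
  apply mem_closure_iff_nhdsWithin_neBot.1
  rw [closure_Iio' (⟨0, ht⟩ : (Set.Iio t).Nonempty)]
  exact Set.mem_Iic.2 le_rfl

lemma tendsto_nhdsLT_congr {V : Type} [TopologicalSpace V] {x y : ℝ≥0 → V} {t : ℝ≥0}
    (h : Set.EqOn x y (Set.Iio t)) (l : V) :
    Tendsto x (𝓝[<] t) (𝓝 l) ↔ Tendsto y (𝓝[<] t) (𝓝 l) :=
  tendsto_congr' (by filter_upwards [self_mem_nhdsWithin] with s hs using h hs)

/-- Where no left limit exists, or at time 0, `Function.leftLim` defaults to the value at t.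
Agreement before t is then not enough, which is why `h'` is required. -/
lemma leftLim_congr {V : Type} [TopologicalSpace V] [T2Space V] {x y : ℝ≥0 → V} {t : ℝ≥0}
    (h : Set.EqOn x y (Set.Iio t)) (h' : x t = y t ∨ Function.leftLim x t = y t) :
    Function.leftLim x t = Function.leftLim y t := by
  by_cases hl : ∃ l, Tendsto x (𝓝[<] t) (𝓝 l)
  · rcases eq_or_neBot (𝓝[<] t) with hb | hb
    · rw [leftLim_eq_of_eq_bot x hb] at h' ⊢
      rw [leftLim_eq_of_eq_bot y hb]
      exact h'.elim id id
    · obtain ⟨l, hl⟩ := hl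
      rw [leftLim_eq_of_tendsto hl, leftLim_eq_of_tendsto ((tendsto_nhdsLT_congr h l).1 hl)]
  · have hr : ¬∃ l, Tendsto y (𝓝[<] t) (𝓝 l) := by
      simpa only [← tendsto_nhdsLT_congr h] using hl
    rw [leftLim_eq_of_not_tendsto x hl] at h' ⊢
    rw [leftLim_eq_of_not_tendsto y hr]
    exact h'.elim id id

lemma IsCadlag.tendsto_leftLim {V : Type} [TopologicalSpace V] [T2Space V] {x : ℝ≥0 → V}
    (hx : IsCadlag x) (t : ℝ≥0) : Tendsto x (𝓝[<] t) (𝓝 (Function.leftLim x t)) := by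
  rcases eq_or_ne t 0 with rfl | ht
  · have : Set.Iio (0 : ℝ≥0) = ∅ := by ext; simp
    rw [this, nhdsWithin_empty]; exact tendsto_bot
  · have := nhdsLT_neBot (pos_iff_ne_zero.2 ht)
    obtain ⟨l, hl⟩ := (hx t).2
    rwa [leftLim_eq_of_tendsto hl]

lemma leftLim_stopLeft (x : Traj m) (t : ℝ≥0) :
    Function.leftLim (stopLeft x t) t = Function.leftLim x t := by
  symm
  refine leftLim_congr (fun s hs => ?_) (Or.inr ?_)
  · simp only [stopLeft, if_pos (Set.mem_Iio.1 hs)]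
  · simp [stopLeft]

lemma leftLim_stopAt (x : Traj m) (t : ℝ≥0) :
    Function.leftLim (stopAt x t) t = Function.leftLim x t :=
  leftLim_congr (fun s hs => by simp only [stopAt, min_eq_left (Set.mem_Iio.1 hs).le])
    (Or.inl (by simp [stopAt]))

lemma jump_stopAt (x : Traj m) (t : ℝ≥0) : jump (stopAt x t) t = jump x t := by
  rw [jump, leftLim_stopAt]; simp [jump, stopAt]

lemma stopLeft_stopLeft (x : Traj m) (t : ℝ≥0) :
    stopLeft (stopLeft x t) t = stopLeft x t := by
  ext1 s
  by_cases h : s < t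
  · simp [stopLeft, h]
  · rw [stopLeft, if_neg h, leftLim_stopLeft, stopLeft, if_neg h]

lemma stopLeft_stopAt (x : Traj m) (t : ℝ≥0) :
    stopLeft (stopAt x t) t = stopLeft x t := by
  ext1 s
  by_cases h : s < t
  · simp [stopLeft, stopAt, h, h.le]
  · rw [stopLeft, if_neg h, leftLim_stopAt, stopLeft, if_neg h]

lemma stopAt_stopLeft (x : Traj m) (t : ℝ≥0) : stopAt (stopLeft x t) t = stopLeft x t := by
  ext1 s
  by_cases h : s < t
  · simp [stopLeft, stopAt, h, h.le]
  · simp [stopLeft, stopAt, h, not_lt.1 h]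

lemma stopAt_stopAt (x : Traj m) (s t : ℝ≥0) : stopAt (stopAt x t) s = stopAt x (min s t) := by
  ext1 r
  simp [stopAt, min_assoc]

lemma stopAt_stopAt_of_le (x : Traj m) {s t : ℝ≥0} (h : s ≤ t) :
    stopAt (stopAt x t) s = stopAt x s := by
  rw [stopAt_stopAt, min_eq_left h]

lemma bump_zero (x : Traj m) (t : ℝ≥0) : bump x t 0 = x := by
  ext1 s; simp [bump]

lemma bump_bump (x : Traj m) (t : ℝ≥0) (e f : EuclideanSpace ℝ (Fin m)) :
    bump (bump x t e) t f = bump x t (e + f) := by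
  ext1 s
  by_cases h : t ≤ s <;> simp [bump, h, add_assoc]

lemma bump_stopLeft (x : Traj m) (t : ℝ≥0) (e : EuclideanSpace ℝ (Fin m)) :
    bump (stopLeft x t) t e = bump (stopAt x t) t (e - jump x t) := by
  ext1 s
  rcases le_or_gt t s with h | h
  · simp [bump, stopLeft, stopAt, h, not_lt.2 h, jump]; abel
  · simp [bump, stopLeft, stopAt, h, h.le, not_le.2 h]

lemma stopLeft_eq_bump (x : Traj m) (t : ℝ≥0) :
    stopLeft x t = bump (stopAt x t) t (-jump x t) := by
  rw [← bump_zero (stopLeft x t) t, bump_stopLeft, zero_sub]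

lemma stopAt_bump_stopAt (x : Traj m) (t : ℝ≥0) (e : EuclideanSpace ℝ (Fin m)) :
    stopAt (bump (stopAt x t) t e) t = bump (stopAt x t) t e := by
  ext1 s
  by_cases h : t ≤ s
  · simp [bump, stopAt, h]
  · simp [bump, stopAt, h, (not_le.1 h).le]

lemma stopLeft_zero (x : Traj m) : stopLeft x 0 = stopAt x 0 := by
  ext1 s
  simp [stopLeft, stopAt, leftLim_zero]

lemma jump_zero (x : Traj m) : jump x 0 = 0 := by
  simp [jump, leftLim_zero]

lemma stopLeft_eq_stopAt {x : Traj m} {t : ℝ≥0} (h : jump x t = 0) :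
    stopLeft x t = stopAt x t := by
  rw [stopLeft_eq_bump, h, neg_zero, bump_zero]

/-! ### Membership in generic sets -/

section Generic
variable {π : PartitionSeq} {Ω : Set (Traj m)}

lemma IsGeneric.stopAt_mem (hΩ : IsGeneric π Ω) {x : Traj m} (hx : x ∈ Ω) (t : ℝ≥0) :
    stopAt x t ∈ Ω := by
  obtain ⟨U, -, hU, -, h⟩ := hΩ.bump_mem x hx t
  have := h 0 (mem_of_mem_nhds hU)
  rwa [bump_zero] at this

/-- This is the role of the clause -Δx(t) ∈ U in the definition of a generic set: the perturbation
by -Δx(t) removes the last jump. -/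
lemma IsGeneric.stopLeft_mem (hΩ : IsGeneric π Ω) {x : Traj m} (hx : x ∈ Ω) (t : ℝ≥0) :
    stopLeft x t ∈ Ω := by
  obtain ⟨U, -, -, hU, h⟩ := hΩ.bump_mem x hx t
  rw [stopLeft_eq_bump]
  exact h _ hU

lemma IsGeneric.eventually_approx (hΩ : IsGeneric π Ω) {x : Traj m} (hx : x ∈ Ω) (T : ℝ≥0) :
    ∀ᶠ n in atTop, ∀ t ≤ T, stopAt (approx (π.pts n) x) t ∈ Ω := by
  filter_upwards [hΩ.approx_mem x hx (T + 1) (by positivity)] with n hn t ht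
  have := hΩ.stopAt_mem hn t
  rwa [stopAt_stopAt_of_le _ (ht.trans (by simp))] at this

/-- The whole segment between `x_{t-}` and `x_t` stays in a generic set. -/
lemma IsGeneric.segment_mem (hΩ : IsGeneric π Ω) {x : Traj m} {t : ℝ≥0} (hx : stopAt x t ∈ Ω)
    {θ : ℝ} (h0 : 0 ≤ θ) (h1 : θ ≤ 1) :
    bump (stopLeft x t) t (θ • jump x t) ∈ Ω := by
  obtain ⟨U, hU, hU0, hUj, h⟩ := hΩ.bump_mem _ hx t
  rw [stopAt_stopAt_of_le _ le_rfl] at h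
  rw [jump_stopAt] at hUj
  rw [bump_stopLeft]
  apply h
  have := hU (mem_of_mem_nhds hU0) hUj h0 (sub_nonneg.2 h1) (by ring)
  convert this using 1
  rw [smul_zero, zero_add, sub_smul, smul_neg, one_smul, smul_neg]; abel

lemma mem_domain_stopAt {x : Traj m} (hx : x ∈ Ω) (t : ℝ≥0) : (t, stopAt x t) ∈ domain Ω :=
  ⟨t, x, hx, rfl⟩

lemma mem_domain_stopLeft (hΩ : IsGeneric π Ω) {x : Traj m} (hx : x ∈ Ω) (t : ℝ≥0) :
    (t, stopLeft x t) ∈ domain Ω :=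
  ⟨t, stopLeft x t, hΩ.stopLeft_mem hx t, by rw [stopAt_stopLeft]⟩

end Generic

/-! ### Limits along a sequence of partitions -/

section Mesh
variable (π : PartitionSeq)

lemma PartitionSeq.eventually_lt_sup (T : ℝ≥0) : ∀ᶠ n in atTop, T < (π.pts n).sup id :=
  π.tendsto_last.eventually_gt_atTop T

/-- Once the last partition point exceeds t, the interval starting at the preceding point reaches t,
and the mesh condition bounds its length. -/
lemma PartitionSeq.tendsto_prev (t : ℝ≥0) :
    Tendsto (fun n => prev (π.pts n) t) atTop (𝓝 t) := by
  rw [tendsto_order]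
  refine ⟨fun a ha => ?_, fun a ha => Eventually.of_forall fun n => (prev_le _ _).trans_lt ha⟩
  filter_upwards [π.mesh t (t - a) (tsub_pos_of_lt ha), π.eventually_lt_sup t] with n hn hn'
  have h1 := hn _ (prev_mem (π.zero_mem n) t) (prev_le _ t)
  have h2 := (le_next_prev hn'.le).trans_lt h1
  by_contra! h3
  have : prev (π.pts n) t + (t - a) ≤ t := by
    calc _ ≤ a + (t - a) := by gcongr
      _ = t := add_tsub_cancel_of_le ha.le
  exact absurd h2 (not_lt.2 this)

lemma PartitionSeq.tendsto_next {t : ℝ≥0} {s : ℕ → ℝ≥0} (hs : Tendsto s atTop (𝓝 t))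
    (hmem : ∀ᶠ n in atTop, s n ∈ π.pts n) :
    Tendsto (fun n => next (π.pts n) (s n)) atTop (𝓝 t) := by
  rw [tendsto_order]
  refine ⟨fun a ha => ?_, fun a ha => ?_⟩
  · filter_upwards [hmem, hs.eventually_const_lt ha] with n hn hn'
    exact hn'.trans_le (le_next_of_mem hn)
  · obtain ⟨b, hb, hba⟩ := exists_between ha
    filter_upwards [hmem, π.mesh b (a - b) (tsub_pos_of_lt hba), hs.eventually_lt_const hb]
      with n h1 h2 h3
    calc next (π.pts n) (s n) < s n + (a - b) := h2 _ h1 h3.le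
      _ ≤ b + (a - b) := by gcongr
      _ = a := add_tsub_cancel_of_le hba.le

lemma PartitionSeq.eventually_prev_pos {t : ℝ≥0} (ht : 0 < t) :
    ∀ᶠ n in atTop, 0 < prev (π.pts n) t :=
  (π.tendsto_prev t).eventually_const_lt ht

lemma IsCadlag.tendsto_right {V : Type} [TopologicalSpace V] {x : ℝ≥0 → V}
    (hx : IsCadlag x) {t : ℝ≥0} {s : ℕ → ℝ≥0} (hs : Tendsto s atTop (𝓝 t))
    (h : ∀ᶠ n in atTop, t ≤ s n) : Tendsto (fun n => x (s n)) atTop (𝓝 (x t)) :=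
  (hx t).1.tendsto.comp (tendsto_nhdsWithin_iff.2 ⟨hs, h⟩)

lemma IsCadlag.tendsto_left {V : Type} [TopologicalSpace V] [T2Space V] {x : ℝ≥0 → V}
    (hx : IsCadlag x) {t : ℝ≥0} {s : ℕ → ℝ≥0} (hs : Tendsto s atTop (𝓝 t))
    (h : ∀ᶠ n in atTop, s n < t) :
    Tendsto (fun n => x (s n)) atTop (𝓝 (Function.leftLim x t)) :=
  (hx.tendsto_leftLim t).comp (tendsto_nhdsWithin_iff.2 ⟨hs, h⟩)

/-- The increment of `x` over the partition interval containing `t` tends to `Δx(t)`. -/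
lemma tendsto_increment_prev {x : Traj m} (hx : IsCadlag x) {t : ℝ≥0} (ht : 0 < t) :
    Tendsto (fun n => x (next (π.pts n) (prev (π.pts n) t)) - x (prev (π.pts n) t)) atTop
      (𝓝 (jump x t)) := by
  have hp := π.tendsto_prev t
  refine Tendsto.sub (hx.tendsto_right (π.tendsto_next hp ?_) ?_) (hx.tendsto_left hp ?_)
  · exact Eventually.of_forall fun n => prev_mem (π.zero_mem n) t
  · filter_upwards [π.eventually_lt_sup t] with n hn using le_next_prev hn.le
  · exact Eventually.of_forall fun n => prev_lt ht

lemma IsCadlag.continuousAt {x : Traj m} (hx : IsCadlag x) {t : ℝ≥0}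
    (h : jump x t = 0) : ContinuousAt x t := by
  have h1 := hx.tendsto_leftLim t
  rw [← sub_eq_zero.1 h] at h1
  rw [continuousAt_iff_continuous_left_right, ← continuousWithinAt_Iio_iff_Iic]
  exact ⟨h1, (hx t).1⟩

end Mesh

/-! ### The piecewise constant approximations -/

section Approx
variable {P : Finset ℝ≥0}

lemma approx_eventually_right (h0 : 0 ∈ P) (x : Traj m) {t : ℝ≥0} (ht : t < P.sup id) :
    ∀ᶠ s in 𝓝[≥] t, approx P x s = approx P x t ∧ next P s = next P t := by
  filter_upwards [Ico_mem_nhdsGE (lt_next ht)] with s hs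
  have hs' : s < P.sup id := hs.2.trans_le (Finset.le_sup (f := id) (next_mem ⟨0, h0⟩ t))
  have : next P s = next P t := by
    refine le_antisymm (next_le (next_mem ⟨0, h0⟩ t) hs.2) ?_
    by_contra! h
    exact absurd (next_le (next_mem ⟨0, h0⟩ s) (hs.1.trans_lt (lt_next hs'))) (not_le.2 h)
  rw [approx_apply h0 x hs', approx_apply h0 x ht, this]
  exact ⟨rfl, rfl⟩

lemma tendsto_approx_left (h0 : 0 ∈ P) (x : Traj m) {t : ℝ≥0} (hP : t ∈ P) :
    Tendsto (approx P x) (𝓝[<] t) (𝓝 (x t)) := by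
  rcases eq_or_ne t 0 with rfl | ht
  · have : Set.Iio (0 : ℝ≥0) = ∅ := by ext; simp
    rw [this, nhdsWithin_empty]; exact tendsto_bot
  refine tendsto_const_nhds.congr' ?_
  filter_upwards [Ico_mem_nhdsLT (prev_lt (P := P) (pos_iff_ne_zero.2 ht))] with s hs
  rw [approx_apply h0 x (hs.2.trans_le (Finset.le_sup (f := id) hP)), next_eq_of_mem hP hs.1 hs.2]

lemma leftLim_approx (h0 : 0 ∈ P) (x : Traj m) {t : ℝ≥0} (hP : t ∈ P) (ht : 0 < t) :
    Function.leftLim (approx P x) t = x t :=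
  have := nhdsLT_neBot ht
  leftLim_eq_of_tendsto (tendsto_approx_left h0 x hP)

/-- The approximation takes the value of x at the right end of each interval, so just before t it
already equals x(t). The increment over the first interval is therefore never a jump: the
approximation starts at x(t₁). -/
lemma jump_approx (h0 : 0 ∈ P) (x : Traj m) {t : ℝ≥0} (hP : t ∈ P) (ht : 0 < t) (hs : t < P.sup id) :
    jump (approx P x) t = x (next P t) - x t := by
  rw [jump, leftLim_approx h0 x hP ht, approx_apply h0 x hs]

lemma jump_approx_eq_zero (h0 : 0 ∈ P) (x : Traj m) {t : ℝ≥0} (hP : t ∉ P) (hs : t < P.sup id) :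
    jump (approx P x) t = 0 := by
  have ht : 0 < t := pos_iff_ne_zero.2 fun h => hP (h ▸ h0)
  have := nhdsLT_neBot ht
  rw [jump, leftLim_eq_of_tendsto (y := approx P x t), sub_self]
  refine tendsto_const_nhds.congr' ?_
  filter_upwards [Ioo_mem_nhdsLT (prev_lt (P := P) ht)] with s hs'
  rw [approx_apply h0 x hs, approx_apply h0 x (hs'.2.trans hs)]
  congr 1
  have h1 : t < next P t := lt_next hs
  refine le_antisymm ?_ (next_le (next_mem ⟨0, h0⟩ t) (hs'.2.trans h1))
  apply next_le (next_mem ⟨0, h0⟩ s)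
  by_contra! h
  have h2 : next P s < t := lt_of_le_of_ne h fun h3 => hP (h3 ▸ next_mem ⟨0, h0⟩ s)
  exact absurd (le_prev (next_mem ⟨0, h0⟩ s) h2)
    (not_le.2 (hs'.1.trans (lt_next (hs'.2.trans hs))))

end Approx

/-! ### Continuity in the `π`-topology -/

section PiTopology
variable {π : PartitionSeq} {Ω : Set (Traj m)} {F : Functional m ℝ}

/-- In an initial topology convergence is tested on the generating functionals. Hence every mode of
convergence demanded of left- or right-continuous functionals passes to π-continuous ones. -/
lemma IsPiContinuous.tendsto (hF : IsPiContinuous π Ω F) {ι : Type} {l : Filter ι}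
    {z : ι → ℝ≥0 × Traj m} {z₀ : ℝ≥0 × Traj m} (h₀ : z₀ ∈ domain Ω)
    (hz : ∀ᶠ i in l, z i ∈ domain Ω)
    (h : ∀ G : Functional m ℝ, LeftCts π Ω G → RightCts π Ω G →
      Tendsto (fun i => G (z i).1 (z i).2) l (𝓝 (G z₀.1 z₀.2))) :
    Tendsto (fun i => F (z i).1 (z i).2) l (𝓝 (F z₀.1 z₀.2)) := by
  classical
  -- The topology lives on the domain only, so indices whose point lies outside it are sent to the
  -- limit point.
  let w : ι → domain Ω := fun i => if hi : z i ∈ domain Ω then ⟨z i, hi⟩ else ⟨z₀, h₀⟩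
  have hw : ∀ᶠ i in l, (w i : ℝ≥0 × Traj m) = z i := by
    filter_upwards [hz] with i hi
    simp only [w, dif_pos hi]
  have hlim : Tendsto w l (@nhds _ (piTopology π Ω) ⟨z₀, h₀⟩) := by
    rw [piTopology, nhds_iInf, tendsto_iInf]
    intro f
    rw [nhds_iInf, tendsto_iInf]
    rintro ⟨G, hl, hr, hG⟩
    rw [nhds_induced, tendsto_comap_iff, hG]
    refine (h G hl hr).congr' ?_
    filter_upwards [hw] with i hi
    simp only [Function.comp, hG, hi]
  have := ((@Continuous.tendsto _ _ (piTopology π Ω) _ _ hF ⟨z₀, h₀⟩).comp hlim)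
  refine this.congr' ?_
  filter_upwards [hw] with i hi
  simp only [Function.comp, hi]

lemma IsGeneric.eventually_approx_seq (hΩ : IsGeneric π Ω) {x : Traj m} (hx : x ∈ Ω) {t : ℝ≥0}
    {s : ℕ → ℝ≥0} (hs : Tendsto s atTop (𝓝 t)) :
    ∀ᶠ n in atTop, stopAt (approx (π.pts n) x) (s n) ∈ Ω := by
  filter_upwards [hΩ.eventually_approx hx (t + 1),
    hs.eventually_lt_const (show t < t + 1 by simp)] with n hn hn' using hn _ hn'.le

lemma stopAt_mem_domain (hΩ : IsGeneric π Ω) {x : Traj m} {t : ℝ≥0} (hx : stopAt x t ∈ Ω) :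
    (t, stopAt x t) ∈ domain Ω ∧ (t, stopLeft x t) ∈ domain Ω := by
  refine ⟨⟨t, _, hx, by rw [stopAt_stopAt_of_le _ le_rfl]⟩, ?_⟩
  rw [← stopLeft_stopAt]
  exact mem_domain_stopLeft hΩ hx t

lemma IsPiContinuous.leftCts (hΩ : IsGeneric π Ω) (hF : IsPiContinuous π Ω F) :
    LeftCts π Ω F where
  a x hx t := hF.tendsto (z := fun s => (s, stopLeft x s)) (z₀ := (t, stopLeft x t))
    (mem_domain_stopLeft hΩ hx t) (.of_forall fun s => mem_domain_stopLeft hΩ hx s)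
    fun _ hl _ => hl.a x hx t
  b x hx t := hF.tendsto (z := fun s => (s, stopAt x s)) (z₀ := (t, stopLeft x t))
    (mem_domain_stopLeft hΩ hx t) (.of_forall fun s => mem_domain_stopAt hx s)
    fun _ hl _ => hl.b x hx t
  c x hx t s hs hs' :=
    hF.tendsto (z := fun n => (s n, stopLeft (approx (π.pts n) x) (s n))) (z₀ := (t, stopLeft x t))
    (mem_domain_stopLeft hΩ hx t)
    ((hΩ.eventually_approx_seq hx hs).mono fun _ h => (stopAt_mem_domain hΩ h).2)
    fun _ hl _ => hl.c x hx t s hs hs'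
  d x hx t s hs hs' :=
    hF.tendsto (z := fun n => (s n, stopAt (approx (π.pts n) x) (s n))) (z₀ := (t, stopLeft x t))
    (mem_domain_stopLeft hΩ hx t)
    ((hΩ.eventually_approx_seq hx hs).mono fun _ h => (stopAt_mem_domain hΩ h).1)
    fun _ hl _ => hl.d x hx t s hs hs'

lemma IsPiContinuous.rightCts (hΩ : IsGeneric π Ω) (hF : IsPiContinuous π Ω F) :
    RightCts π Ω F where
  a x hx t := hF.tendsto (z := fun s => (s, stopAt x s)) (z₀ := (t, stopAt x t))
    (mem_domain_stopAt hx t) (.of_forall fun s => mem_domain_stopAt hx s)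
    fun _ _ hr => hr.a x hx t
  b x hx t := hF.tendsto (z := fun s => (s, stopLeft x s)) (z₀ := (t, stopAt x t))
    (mem_domain_stopAt hx t) (.of_forall fun s => mem_domain_stopLeft hΩ hx s)
    fun _ _ hr => hr.b x hx t
  c x hx t s hs hs' :=
    hF.tendsto (z := fun n => (s n, stopAt (approx (π.pts n) x) (s n))) (z₀ := (t, stopAt x t))
    (mem_domain_stopAt hx t)
    ((hΩ.eventually_approx_seq hx hs).mono fun _ h => (stopAt_mem_domain hΩ h).1)
    fun _ _ hr => hr.c x hx t s hs hs'
  d x hx t s hs hs' :=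
    hF.tendsto (z := fun n => (s n, stopLeft (approx (π.pts n) x) (s n))) (z₀ := (t, stopAt x t))
    (mem_domain_stopAt hx t)
    ((hΩ.eventually_approx_seq hx hs).mono fun _ h => (stopAt_mem_domain hΩ h).2)
    fun _ _ hr => hr.d x hx t s hs hs'

end PiTopology

/-- Left-continuity along a sequence whose constraint holds only eventually. -/
lemma LeftCts.tendsto_approx {π : PartitionSeq} {Ω : Set (Traj m)} {F : Functional m ℝ}
    (hF : LeftCts π Ω F) {x : Traj m} (hx : x ∈ Ω) {t : ℝ≥0} {s : ℕ → ℝ≥0}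
    (hs : Tendsto s atTop (𝓝 t)) (h : ∀ᶠ n in atTop, s n ≤ prev (π.pts n) t) :
    Tendsto (fun n => F (s n) (stopLeft (approx (π.pts n) x) (s n))) atTop
      (𝓝 (F t (stopLeft x t))) := by
  have heq : (fun n => min (s n) (prev (π.pts n) t)) =ᶠ[atTop] s := by
    filter_upwards [h] with n hn using min_eq_left hn
  refine (hF.c x hx t _ (hs.congr' heq.symm) fun n => min_le_right _ _).congr' ?_
  filter_upwards [h] with n hn
  simp only [min_eq_left hn]

/-! ### Cumulative sums along a partition and their Skorokhod limits -/

/-- The sum of `a` over the points of `P` up to and including `t`. -/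
noncomputable def cumul (P : Finset ℝ≥0) (a : ℝ≥0 → ℝ) (t : ℝ≥0) : ℝ := ∑ u ∈ P.filter (fun u => u ≤ t), a u

/-- The sum of `a` over the points of `P` before `t`. -/
noncomputable def cumulLt (P : Finset ℝ≥0) (a : ℝ≥0 → ℝ) (t : ℝ≥0) : ℝ := ∑ u ∈ P.filter (fun u => u < t), a u

lemma cumul_eq_cumulLt_add (P : Finset ℝ≥0) (a : ℝ≥0 → ℝ) (t : ℝ≥0) :
    cumul P a t = cumulLt P a t + if t ∈ P then a t else 0 := by
  simp only [cumul, cumulLt, Finset.sum_filter]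
  rw [← Finset.sum_ite_eq' P t a, ← Finset.sum_add_distrib]
  refine Finset.sum_congr rfl fun u _ => ?_
  rcases lt_trichotomy u t with h | h | h
  · simp [h, h.le, h.ne]
  · simp [h]
  · simp [h.not_gt, h.not_ge, h.ne']

lemma cumul_prev {P : Finset ℝ≥0} (a : ℝ≥0 → ℝ) {t : ℝ≥0} (ht : 0 < t) :
    cumul P a (prev P t) = cumulLt P a t := by
  unfold cumul cumulLt
  congr 1
  apply Finset.filter_congr
  intro u hu
  exact ⟨fun h => h.trans_lt (prev_lt ht), fun h => le_prev hu h⟩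

lemma cumulLt_zero (P : Finset ℝ≥0) (a : ℝ≥0 → ℝ) : cumulLt P a 0 = 0 := by
  simp [cumulLt]

lemma cumul_le_cumulLt {P : Finset ℝ≥0} {a : ℝ≥0 → ℝ} (ha : ∀ u, 0 ≤ a u) {s t : ℝ≥0}
    (h : s < t) : cumul P a s ≤ cumulLt P a t := by
  unfold cumul cumulLt
  refine Finset.sum_le_sum_of_subset_of_nonneg ?_ fun u _ _ => ha u
  intro u hu
  rw [Finset.mem_filter] at hu ⊢
  exact ⟨hu.1, hu.2.trans_lt h⟩

lemma cumulLt_mono {P : Finset ℝ≥0} {a : ℝ≥0 → ℝ} (ha : ∀ u, 0 ≤ a u) : Monotone (cumulLt P a) := by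
  intro s t h
  unfold cumulLt
  refine Finset.sum_le_sum_of_subset_of_nonneg ?_ fun u _ _ => ha u
  intro u hu
  rw [Finset.mem_filter] at hu ⊢
  exact ⟨hu.1, hu.2.trans_le h⟩

lemma cumul_mono {P : Finset ℝ≥0} {a : ℝ≥0 → ℝ} (ha : ∀ u, 0 ≤ a u) : Monotone (cumul P a) := by
  intro s t h
  unfold cumul
  refine Finset.sum_le_sum_of_subset_of_nonneg ?_ fun u _ _ => ha u
  intro u hu
  rw [Finset.mem_filter] at hu ⊢
  exact ⟨hu.1, hu.2.trans h⟩

lemma PartitionSeq.tendsto_prev_seq (π : PartitionSeq) {t : ℝ≥0} {s : ℕ → ℝ≥0}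
    (hs : Tendsto s atTop (𝓝 t)) : Tendsto (fun n => prev (π.pts n) (s n)) atTop (𝓝 t) := by
  rw [tendsto_order]
  refine ⟨fun a ha => ?_, fun a ha => ?_⟩
  · obtain ⟨b, hab, hbt⟩ := exists_between ha
    filter_upwards [(π.tendsto_prev b).eventually_const_lt hab, hs.eventually_const_lt hbt]
      with n h1 h2
    exact h1.trans_le (le_prev (prev_mem (π.zero_mem n) b) ((prev_le _ _).trans_lt h2))
  · filter_upwards [hs.eventually_lt_const ha] with n h1 using (prev_le _ _).trans_lt h1

/-! ### Time-changed limits along convergent sequences of times -/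

section Skorokhod

variable {q : ℕ → ℝ≥0 → ℝ} {G : ℝ≥0 → ℝ} {lam : ℕ → ℝ≥0 ≃o ℝ≥0}

/-- The time changes are uniformly close to the identity on all of [0,∞), so the estimate may be
applied at the preimages of s n, without knowing beforehand that these stay bounded. -/
lemma tendsto_timeChange_symm (h1 : TendstoUniformly (fun n s => lam n s) id atTop)
    {t : ℝ≥0} {s : ℕ → ℝ≥0} (hs : Tendsto s atTop (𝓝 t)) :
    Tendsto (fun n => (lam n).symm (s n)) atTop (𝓝 t) := by
  rw [Metric.tendsto_atTop'] at hs ⊢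
  intro ε hε
  obtain ⟨N, hN⟩ := hs (ε / 2) (by positivity)
  rw [Metric.tendstoUniformly_iff] at h1
  obtain ⟨N', hN'⟩ := eventually_atTop.1 (h1 (ε / 2) (by positivity))
  refine ⟨max N N', fun n hn => ?_⟩
  have e1 := hN n ((le_max_left _ _).trans_lt hn)
  have e2 := hN' n ((le_max_right _ _).trans hn.le) ((lam n).symm (s n))
  simp only [OrderIso.apply_symm_apply, id] at e2
  calc _ ≤ dist ((lam n).symm (s n)) (s n) + dist (s n) t := dist_triangle _ _ _
    _ < ε := by linarith

/-- Uniform convergence is evaluated at the preimage of s n under the time change, which eventually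
lies below t + 1. The behaviour of q n (s n) thus depends only on the side of t from which these
preimages approach. -/
lemma tendsto_sub_timeChange (h1 : TendstoUniformly (fun n s => lam n s) id atTop)
    (h2 : ∀ N : ℝ≥0, TendstoUniformlyOn (fun n s => q n (lam n s)) G atTop (Set.Iic N))
    {t : ℝ≥0} {s : ℕ → ℝ≥0} (hs : Tendsto s atTop (𝓝 t)) :
    Tendsto (fun n => q n (s n) - G ((lam n).symm (s n))) atTop (𝓝 0) := by
  have hr := tendsto_timeChange_symm h1 hs
  have h2' := h2 (t + 1)
  rw [Metric.tendstoUniformlyOn_iff] at h2'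
  rw [Metric.tendsto_nhds]
  intro ε hε
  filter_upwards [h2' ε hε, hr.eventually_lt_const (show t < t + 1 by simp)] with n hn hn'
  have := hn _ (Set.mem_Iic.2 hn'.le)
  rw [OrderIso.apply_symm_apply, dist_comm] at this
  rwa [dist_zero_right, ← dist_eq_norm]

lemma tendsto_of_timeChange_le (h1 : TendstoUniformly (fun n s => lam n s) id atTop)
    (h2 : ∀ N : ℝ≥0, TendstoUniformlyOn (fun n s => q n (lam n s)) G atTop (Set.Iic N))
    (hG : IsCadlag G) {t : ℝ≥0} {s : ℕ → ℝ≥0} (hs : Tendsto s atTop (𝓝 t))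
    (h : ∀ᶠ n in atTop, lam n t ≤ s n) : Tendsto (fun n => q n (s n)) atTop (𝓝 (G t)) := by
  have := (tendsto_sub_timeChange h1 h2 hs).add
    (hG.tendsto_right (tendsto_timeChange_symm h1 hs) ?_)
  · simpa using this
  · filter_upwards [h] with n hn
    rwa [OrderIso.le_symm_apply]

lemma tendsto_of_lt_timeChange (h1 : TendstoUniformly (fun n s => lam n s) id atTop)
    (h2 : ∀ N : ℝ≥0, TendstoUniformlyOn (fun n s => q n (lam n s)) G atTop (Set.Iic N))
    (hG : IsCadlag G) {t : ℝ≥0} {s : ℕ → ℝ≥0} (hs : Tendsto s atTop (𝓝 t))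
    (h : ∀ᶠ n in atTop, s n < lam n t) :
    Tendsto (fun n => q n (s n)) atTop (𝓝 (Function.leftLim G t)) := by
  have := (tendsto_sub_timeChange h1 h2 hs).add
    (hG.tendsto_left (tendsto_timeChange_symm h1 hs) ?_)
  · simpa using this
  · filter_upwards [h] with n hn
    rwa [OrderIso.symm_apply_lt]

/-- At a continuity point of the limit, no relation between time change and sequence is needed. -/
lemma tendsto_of_leftLim_eq (h1 : TendstoUniformly (fun n s => lam n s) id atTop)
    (h2 : ∀ N : ℝ≥0, TendstoUniformlyOn (fun n s => q n (lam n s)) G atTop (Set.Iic N))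
    (hG : IsCadlag G) {t : ℝ≥0} {s : ℕ → ℝ≥0} (hs : Tendsto s atTop (𝓝 t))
    (h : Function.leftLim G t = G t) : Tendsto (fun n => q n (s n)) atTop (𝓝 (G t)) := by
  have hc : ContinuousAt G t := by
    rw [continuousAt_iff_continuous_left_right, ← continuousWithinAt_Iio_iff_Iic]
    refine ⟨?_, (hG t).1⟩
    have := hG.tendsto_leftLim t
    rwa [h] at this
  simpa using (tendsto_sub_timeChange h1 h2 hs).add
    (hc.tendsto.comp (tendsto_timeChange_symm h1 hs))

end Skorokhod

/-! ### Skorokhod limits of sums of increment weights -/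

section SkorokhodCumul
variable (π : PartitionSeq) {x : Traj m} (b : EuclideanSpace ℝ (Fin m) → ℝ) {G : ℝ≥0 → ℝ}

/-- The weight `b(x(next t) - x(t))` of a partition point `t`. -/
noncomputable def weight (P : Finset ℝ≥0) (x : Traj m) (b : EuclideanSpace ℝ (Fin m) → ℝ) (t : ℝ≥0) : ℝ :=
  b (x (next P t) - x t)

/-- If the time-changed sums jump at `t` in the limit, then the time change eventually maps `t` to
the left end point of the partition interval containing `t`. -/
lemma eventually_timeChange_eq_prev (hx : IsCadlag x) (hb : Continuous b) (hb0 : b 0 = 0)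
    (hG : IsCadlag G) {lam : ℕ → ℝ≥0 ≃o ℝ≥0}
    (h1 : TendstoUniformly (fun n s => lam n s) id atTop)
    (h2 : ∀ N : ℝ≥0, TendstoUniformlyOn
      (fun n s => cumul (π.pts n) (weight (π.pts n) x b) (lam n s)) G atTop (Set.Iic N))
    {t : ℝ≥0} (ht : 0 < t) (hj : Function.leftLim G t ≠ G t) :
    ∀ᶠ n in atTop, lam n t = prev (π.pts n) t ∧ prev (π.pts n) t < t := by
  have hl : Tendsto (fun n => lam n t) atTop (𝓝 t) := h1.tendsto_at t
  have hpos : ∀ n, 0 < lam n t := fun n => by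
    have := (lam n).strictMono ht
    exact pos_of_gt this
  have e1 := tendsto_of_timeChange_le h1 h2 hG hl (.of_forall fun n => le_rfl)
  have e2 := tendsto_of_lt_timeChange h1 h2 hG (π.tendsto_prev_seq hl)
    (.of_forall fun n => prev_lt (hpos n))
  have e3 := (e1.sub e2).abs
  -- The sums at `lam n t` and at the partition point before it differ by the single term at `lam n
  -- t`, which is present only if that is a partition point.
  simp only [cumul_prev _ (hpos _), cumul_eq_cumulLt_add, add_sub_cancel_left] at e3
  obtain ⟨c, hc0, hc⟩ : ∃ c > 0, c < |G t - Function.leftLim G t| :=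
    exists_between (abs_pos.2 (sub_ne_zero.2 hj.symm))
  have e4 := e3.eventually_const_lt hc
  have hmem : ∀ᶠ n in atTop, lam n t ∈ π.pts n := by
    filter_upwards [e4] with n hn
    by_contra h
    rw [if_neg h, abs_zero] at hn
    exact absurd hn (not_lt.2 hc0.le)
  have hn := π.tendsto_next hl hmem
  obtain ⟨η, hη, hbη⟩ := Metric.continuousAt_iff.1 hb.continuousAt c hc0
  have r1 : ∀ᶠ s in 𝓝 t, t ≤ s → dist (x s) (x t) < η / 2 :=
    eventually_nhdsWithin_iff.1 ((hx t).1.tendsto.eventually (Metric.ball_mem_nhds _ (half_pos hη)))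
  have r2 : ∀ᶠ s in 𝓝 t, s < t → dist (x s) (Function.leftLim x t) < η / 2 :=
    eventually_nhdsWithin_iff.1
      ((hx.tendsto_leftLim t).eventually (Metric.ball_mem_nhds _ (half_pos hη)))
  filter_upwards [hmem, e4, hl.eventually r1, hl.eventually r2, hn.eventually r1, hn.eventually r2]
    with n m1 m2 m3 m4 m5 m6
  rw [if_pos m1] at m2
  -- If both ends of the interval starting at `lam n t` were on the same side of t, the values of x
  -- there would be close to one and the same limit, and the weight would be smaller than c.
  have key : ∀ v, dist (x (next (π.pts n) (lam n t))) v < η / 2 → dist (x (lam n t)) v < η / 2 →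
      False := by
    intro v k1 k2
    have k3 : dist (x (next (π.pts n) (lam n t)) - x (lam n t)) 0 < η := by
      rw [dist_zero_right, ← dist_eq_norm]
      linarith [dist_triangle_right (x (next (π.pts n) (lam n t))) (x (lam n t)) v]
    have k4 := hbη k3
    rw [hb0, Real.dist_eq, sub_zero] at k4
    exact absurd m2 (not_lt.2 k4.le)
  have hle := le_next_of_mem m1
  refine ⟨eq_prev m1 ?_ ?_, prev_lt ht⟩
  · by_contra! h
    exact key _ (m5 (h.trans hle)) (m3 h)
  · by_contra! h
    exact key _ (m6 h) (m4 (hle.trans_lt h))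

lemma tendsto_weight_zero (hx : IsCadlag x) (hb : Continuous b) (hb0 : b 0 = 0) :
    Tendsto (fun n => weight (π.pts n) x b 0) atTop (𝓝 0) := by
  have hn := π.tendsto_next (tendsto_const_nhds (x := (0 : ℝ≥0))) (.of_forall π.zero_mem)
  have := (hx.tendsto_right hn (.of_forall fun n => zero_le)).sub_const (x 0)
  rw [sub_self] at this
  have h := (hb.tendsto 0).comp this
  rwa [hb0] at h

lemma cumul_zero {P : Finset ℝ≥0} (h0 : 0 ∈ P) (a : ℝ≥0 → ℝ) : cumul P a 0 = a 0 := by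
  rw [cumul_eq_cumulLt_add, cumulLt_zero, if_pos h0, zero_add]

/-- Time changes fix 0, and the sum at 0 is the single weight of the first interval, which vanishes
in the limit by right-continuity of x. -/
lemma skorokhod_limit_zero (hx : IsCadlag x) (hb : Continuous b) (hb0 : b 0 = 0)
    (hS : SkorokhodTendsto (fun n => cumul (π.pts n) (weight (π.pts n) x b)) G) : G 0 = 0 := by
  obtain ⟨lam, h1, h2⟩ := hS
  have := (h2 0).tendsto_at (Set.mem_Iic.2 le_rfl)
  simp only [← bot_eq_zero', OrderIso.map_bot] at this
  simp only [bot_eq_zero', cumul_zero (π.zero_mem _)] at this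
  exact tendsto_nhds_unique this (tendsto_weight_zero π b hx hb hb0)

/-- Skorokhod convergence of the sums implies their convergence at every time; moreover the sums
see each jump of the limit at the partition interval containing it. -/
lemma skorokhod_tendsto_cumul (hx : IsCadlag x) (hb : Continuous b) (hb0 : b 0 = 0)
    (hG : IsCadlag G)
    (hS : SkorokhodTendsto (fun n => cumul (π.pts n) (weight (π.pts n) x b)) G)
    {t : ℝ≥0} (ht : 0 < t) :
    Tendsto (fun n => cumul (π.pts n) (weight (π.pts n) x b) t) atTop (𝓝 (G t)) ∧
    Tendsto (fun n => cumulLt (π.pts n) (weight (π.pts n) x b) t) atTop (𝓝 (G t)) ∧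
    Tendsto (fun n => cumulLt (π.pts n) (weight (π.pts n) x b) (prev (π.pts n) t)) atTop
      (𝓝 (Function.leftLim G t)) := by
  obtain ⟨lam, h1, h2⟩ := hS
  have hp := π.tendsto_prev t
  have hpp := π.tendsto_prev_seq hp
  have c3 : (fun n => cumul (π.pts n) (weight (π.pts n) x b) (prev (π.pts n) (prev (π.pts n) t)))
      =ᶠ[atTop] fun n => cumulLt (π.pts n) (weight (π.pts n) x b) (prev (π.pts n) t) := by
    filter_upwards [π.eventually_prev_pos ht] with n hn using cumul_prev _ hn
  simp only [← cumul_prev _ ht]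
  by_cases hj : Function.leftLim G t = G t
  · refine ⟨tendsto_of_leftLim_eq h1 h2 hG tendsto_const_nhds hj,
      tendsto_of_leftLim_eq h1 h2 hG hp hj, ?_⟩
    rw [hj]
    exact (tendsto_of_leftLim_eq h1 h2 hG hpp hj).congr' c3
  -- At a jump of G the time change hits the preceding partition point exactly. That point and t are
  -- then not before the time change of t, whereas one partition point earlier is strictly before
  -- it.
  · have hl := eventually_timeChange_eq_prev π b hx hb hb0 hG h1 h2 ht hj
    refine ⟨tendsto_of_timeChange_le h1 h2 hG tendsto_const_nhds ?_,
      tendsto_of_timeChange_le h1 h2 hG hp ?_,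
      (tendsto_of_lt_timeChange h1 h2 hG hpp ?_).congr' c3⟩
    · filter_upwards [hl] with n hn
      rw [hn.1]; exact hn.2.le
    · filter_upwards [hl] with n hn
      rw [hn.1]
    · filter_upwards [hl, π.eventually_prev_pos ht] with n hn hn'
      rw [hn.1]; exact prev_lt hn'

/-- The jumps of the limit are `b(Δx)`. -/
lemma skorokhod_limit_jump (hx : IsCadlag x) (hb : Continuous b) (hb0 : b 0 = 0)
    (hG : IsCadlag G)
    (hS : SkorokhodTendsto (fun n => cumul (π.pts n) (weight (π.pts n) x b)) G)
    (t : ℝ≥0) : G t - Function.leftLim G t = b (jump x t) := by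
  rcases eq_or_ne t 0 with rfl | ht0
  · rw [leftLim_zero, sub_self, jump_zero, hb0]
  have ht := pos_iff_ne_zero.2 ht0
  obtain ⟨-, h2, h3⟩ := skorokhod_tendsto_cumul π b hx hb hb0 hG hS ht
  have h4 := h2.sub h3
  refine tendsto_nhds_unique h4 (((hb.tendsto _).comp (tendsto_increment_prev π hx ht)).congr ?_)
  intro n
  -- The two sums differ by the one weight at the point preceding t, whose interval contains t.
  rw [← cumul_prev _ ht, cumul_eq_cumulLt_add, if_pos (prev_mem (π.zero_mem n) t)]
  simp [weight]

lemma skorokhod_tendsto_cumul_all (hx : IsCadlag x) (hb : Continuous b) (hb0 : b 0 = 0)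
    (hG : IsCadlag G)
    (hS : SkorokhodTendsto (fun n => cumul (π.pts n) (weight (π.pts n) x b)) G) (t : ℝ≥0) :
    Tendsto (fun n => cumul (π.pts n) (weight (π.pts n) x b) t) atTop (𝓝 (G t)) := by
  rcases eq_or_ne t 0 with rfl | ht0
  · rw [skorokhod_limit_zero π b hx hb hb0 hS]
    simpa only [cumul_zero (π.zero_mem _)] using tendsto_weight_zero π b hx hb hb0
  · exact (skorokhod_tendsto_cumul π b hx hb hb0 hG hS (pos_iff_ne_zero.2 ht0)).1

end SkorokhodCumul

/-! ### Families of functions that converge from the left -/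

/-- If the uniform statement failed, bad points could be chosen along a subsequence of indices.
Filling the other indices with the admissible sequence p gives a full sequence that contradicts the
hypothesis. -/
lemma exists_eventually_of_seq {f : ℕ → ℝ≥0 → ℝ} {A : ℕ → Set ℝ≥0} {t : ℝ≥0} {l : ℝ}
    {p : ℕ → ℝ≥0} (hp : Tendsto p atTop (𝓝 t)) (hpA : ∀ n, p n ∈ A n)
    (h : ∀ s : ℕ → ℝ≥0, Tendsto s atTop (𝓝 t) → (∀ n, s n ∈ A n) →
      Tendsto (fun n => f n (s n)) atTop (𝓝 l)) {ε : ℝ} (hε : 0 < ε) :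
    ∃ δ > 0, ∀ᶠ n in atTop, ∀ s ∈ A n, dist s t < δ → dist (f n s) l < ε := by
  by_contra! hcon
  have h' : ∀ k : ℕ, ∃ᶠ n in atTop, ∃ s ∈ A n, dist s t < 1 / ((k : ℝ) + 1) ∧ ε ≤ dist (f n s) l :=
    fun k => by simpa using hcon (1 / ((k : ℝ) + 1)) (by positivity)
  obtain ⟨φ, hφ, hP⟩ := extraction_forall_of_frequently h'
  choose s hsA hst hsf using hP
  have e1 : ∀ k, Function.extend φ s p (φ k) = s k := fun k => hφ.injective.extend_apply _ _ _
  have e2 : ∀ n, (¬∃ k, φ k = n) → Function.extend φ s p n = p n :=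
    fun n hn => Function.extend_apply' _ _ _ hn
  have hS : Tendsto (Function.extend φ s p) atTop (𝓝 t) := by
    rw [Metric.tendsto_atTop] at hp ⊢
    intro η hη
    obtain ⟨N, hN⟩ := hp η hη
    obtain ⟨k₀, hk₀⟩ := exists_nat_one_div_lt hη
    refine ⟨max N (φ k₀), fun n hn => ?_⟩
    by_cases hk : ∃ k, φ k = n
    · obtain ⟨k, rfl⟩ := hk
      have hk : k₀ ≤ k := hφ.le_iff_le.1 ((le_max_right _ _).trans hn)
      rw [e1]
      refine (hst k).trans (lt_of_le_of_lt ?_ hk₀)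
      gcongr
    · rw [e2 n hk]
      exact hN n ((le_max_left _ _).trans hn)
  have hA : ∀ n, Function.extend φ s p n ∈ A n := by
    intro n
    by_cases hk : ∃ k, φ k = n
    · obtain ⟨k, rfl⟩ := hk
      rw [e1]; exact hsA k
    · rw [e2 n hk]; exact hpA n
  have hlim := (h _ hS hA).comp hφ.tendsto_atTop
  obtain ⟨N, hN⟩ := (Metric.tendsto_atTop.1 hlim) ε hε
  have := hN N le_rfl
  simp only [Function.comp, e1] at this
  exact absurd this (not_lt.2 (hsf N))

/-- The functions `h n` converge to `H` at `t` along all sequences of times converging to `t`. -/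
def ConvergesAt (h : ℕ → ℝ≥0 → ℝ) (H : ℝ≥0 → ℝ) (t : ℝ≥0) : Prop :=
  ∀ s : ℕ → ℝ≥0, Tendsto s atTop (𝓝 t) → Tendsto (fun n => h n (s n)) atTop (𝓝 (H t))

/-- The functions `h n` converge to `H` at every time along sequences of times that stay to the
left of the preceding partition point. -/
def ConvergesLeft (π : PartitionSeq) (h : ℕ → ℝ≥0 → ℝ) (H : ℝ≥0 → ℝ) : Prop :=
  ∀ t, ∀ s : ℕ → ℝ≥0, Tendsto s atTop (𝓝 t) → (∀ᶠ n in atTop, s n ≤ prev (π.pts n) t) →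
    Tendsto (fun n => h n (s n)) atTop (𝓝 (H t))

/-- Let C k be the times where the h n do not become 1/(k+1)-close to H t near t. Just to the left
of any t all the h n are eventually close to H t, so no time slightly before t lies in C k. Each C k
thus has only points isolated from the left, hence is countable. -/
lemma ConvergesLeft.countable {π : PartitionSeq} {h : ℕ → ℝ≥0 → ℝ} {H : ℝ≥0 → ℝ}
    (hc : ConvergesLeft π h H) : {t | ¬ConvergesAt h H t}.Countable := by
  let C : ℕ → Set ℝ≥0 := fun k => {t | ¬∃ δ > 0, ∀ᶠ n in atTop, ∀ s, dist s t < δ →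
    dist (h n s) (H t) ≤ 1 / ((k : ℝ) + 1)}
  have hsub : {t | ¬ConvergesAt h H t} ⊆ ⋃ k, C k := by
    intro t ht
    by_contra hcon
    have hcon : ∀ k : ℕ, ∃ δ > 0, ∀ᶠ n in atTop, ∀ s, dist s t < δ →
        dist (h n s) (H t) ≤ 1 / ((k : ℝ) + 1) := by
      intro k
      by_contra hk
      exact hcon (Set.mem_iUnion.2 ⟨k, hk⟩)
    apply ht
    intro s hs
    rw [Metric.tendsto_nhds]
    intro ε hε
    obtain ⟨k, hk⟩ := exists_nat_one_div_lt hε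
    obtain ⟨δ, hδ, hev⟩ := hcon k
    filter_upwards [hev, hs.eventually (Metric.ball_mem_nhds t hδ)] with n h1 h2
    exact (h1 _ h2).trans_lt hk
  refine (Set.countable_iUnion fun k => ?_).mono hsub
  refine (countable_setOfPred_isolated_left_within (s := C k)).mono fun t ht => ?_
  refine ⟨ht, ?_⟩
  have hε : (0 : ℝ) < 1 / ((k : ℝ) + 1) / 2 := by positivity
  obtain ⟨δ, hδ, hev⟩ := exists_eventually_of_seq (f := h) (A := fun n => Set.Iic (prev (π.pts n) t))
    (π.tendsto_prev t) (fun n => Set.mem_Iic.2 le_rfl) (fun s hs hs' => hc t s hs (.of_forall hs')) hε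
  rw [← empty_mem_iff_bot]
  filter_upwards [mem_nhdsWithin_of_mem_nhds (Metric.ball_mem_nhds t hδ), self_mem_nhdsWithin]
    with t' h1 h2
  obtain ⟨h2, h3⟩ := h2
  apply h2
  -- Since the points preceding t eventually exceed r, a whole two-sided neighbourhood of t' is on
  -- the admissible side of t.
  obtain ⟨r, hr, hrt⟩ := exists_between (Set.mem_Iio.1 h3)
  have hnear : ∀ᶠ s in 𝓝 t', s < r ∧ dist s t < δ :=
    (gt_mem_nhds hr).and (Metric.isOpen_ball.mem_nhds h1)
  have hlim : dist (H t') (H t) ≤ 1 / ((k : ℝ) + 1) / 2 := by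
    have := (hc t' _ (π.tendsto_prev t') (.of_forall fun _ => le_rfl)).dist
      (tendsto_const_nhds (x := H t))
    refine le_of_tendsto this ?_
    filter_upwards [hev, (π.tendsto_prev t').eventually hnear,
      (π.tendsto_prev t).eventually_const_lt hrt] with n k1 k2 k3
    exact (k1 _ (k2.1.trans k3).le k2.2).le
  obtain ⟨δ', hδ', hball⟩ := Metric.eventually_nhds_iff.1 hnear
  refine ⟨δ', hδ', ?_⟩
  filter_upwards [hev, (π.tendsto_prev t).eventually_const_lt hrt] with n k1 k2 s hs
  obtain ⟨k3, k4⟩ := hball hs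
  have := k1 s (k3.trans k2).le k4
  linarith [dist_triangle_right (h n s) (H t') (H t)]

/-! ### Quantiles -/

/-- The generalized inverse of an increasing function `G` on `[0,T]`. -/
noncomputable def quantile (G : ℝ≥0 → ℝ) (T : ℝ≥0) (u : ℝ) : ℝ≥0 := sInf {t | u ≤ G t ∨ T ≤ t}

/-- The measure on `(0,T]` with distribution function `G`. -/
noncomputable def stieltjes (G : ℝ≥0 → ℝ) (T : ℝ≥0) : Measure ℝ≥0 :=
  (volume.restrict (Set.Ioc 0 (G T))).map (quantile G T)

section Quantile
variable {G : ℝ≥0 → ℝ} {T : ℝ≥0}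

lemma quantile_mono : Monotone (quantile G T) := fun _ _ h =>
  csInf_le_csInf (OrderBot.bddBelow _) ⟨T, Or.inr le_rfl⟩
    fun _ ht => ht.imp (fun h' => h.trans h') id

lemma measurable_quantile : Measurable (quantile G T) := quantile_mono.measurable

lemma quantile_le (u : ℝ) : quantile G T u ≤ T := csInf_le (OrderBot.bddBelow _) (Or.inr le_rfl)

/-- Right-continuity makes the infimum attained. The condition u ≤ G T ensures that the truncation
at T, which keeps the set nonempty, does not interfere. -/
lemma quantile_le_iff (hG : Monotone G) (hr : ∀ t, ContinuousWithinAt G (Set.Ici t) t)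
    {u : ℝ} (hu : u ≤ G T) {t : ℝ≥0} : quantile G T u ≤ t ↔ u ≤ G t := by
  refine ⟨fun h => ?_, fun h => csInf_le (OrderBot.bddBelow _) (Or.inl h)⟩
  have h1 : Tendsto G (𝓝[>] t) (𝓝 (G t)) :=
    (hr t).tendsto.mono_left (nhdsWithin_mono _ Set.Ioi_subset_Ici_self)
  refine ge_of_tendsto h1 ?_
  filter_upwards [self_mem_nhdsWithin] with s hs
  obtain ⟨r, hr, hrs⟩ := exists_lt_of_csInf_lt (⟨T, Or.inr le_rfl⟩ : Set.Nonempty _)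
    (lt_of_le_of_lt h (Set.mem_Ioi.1 hs))
  rcases hr with hr | hr
  · exact hr.trans (hG hrs.le)
  · exact hu.trans (hG (hr.trans hrs.le))

lemma lt_quantile_iff (hG : Monotone G) (hr : ∀ t, ContinuousWithinAt G (Set.Ici t) t)
    {u : ℝ} (hu : u ≤ G T) {t : ℝ≥0} : t < quantile G T u ↔ G t < u := by
  rw [← not_le, quantile_le_iff hG hr hu, not_le]

instance : IsFiniteMeasure (stieltjes G T) := by
  unfold stieltjes; infer_instance

lemma stieltjes_Ioc (hG : Monotone G) (hr : ∀ t, ContinuousWithinAt G (Set.Ici t) t)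
    (h0 : G 0 = 0) {s : ℝ≥0} (hs : s ≤ T) : (stieltjes G T).real (Set.Ioc 0 s) = G s := by
  have hset : quantile G T ⁻¹' Set.Ioc 0 s ∩ Set.Ioc 0 (G T) = Set.Ioc 0 (G s) := by
    ext u
    simp only [Set.mem_inter_iff, Set.mem_preimage, Set.mem_Ioc]
    constructor
    · rintro ⟨⟨-, h2⟩, h3, h4⟩
      exact ⟨h3, (quantile_le_iff hG hr h4).1 h2⟩
    · rintro ⟨h1, h2⟩
      have h4 : u ≤ G T := h2.trans (hG hs)
      exact ⟨⟨(lt_quantile_iff hG hr h4).2 (by rwa [h0]), (quantile_le_iff hG hr h4).2 h2⟩, h1, h4⟩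
  have hpos : 0 ≤ G s := h0 ▸ hG zero_le
  rw [Measure.real, stieltjes, Measure.map_apply measurable_quantile measurableSet_Ioc,
    Measure.restrict_apply (measurable_quantile measurableSet_Ioc), hset, Real.volume_Ioc,
    sub_zero, ENNReal.toReal_ofReal hpos]

lemma leftLim_le_of_forall_lt (hG : Monotone G) {s : ℝ≥0} (hs : 0 < s) {u : ℝ}
    (h : ∀ r < s, G r ≤ u) : Function.leftLim G s ≤ u := by
  have := nhdsLT_neBot hs
  refine le_of_tendsto (hG.tendsto_leftLim s) ?_
  filter_upwards [self_mem_nhdsWithin] with r hr using h r hr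

/-- The levels with quantile s lie between the open and the closed interval from G(s-) to G(s),
which have the same length. -/
lemma stieltjes_singleton (hG : Monotone G) (hr : ∀ t, ContinuousWithinAt G (Set.Ici t) t)
    (h0 : G 0 = 0) {s : ℝ≥0} (hs : s ≤ T) :
    (stieltjes G T).real {s} = G s - Function.leftLim G s := by
  have hle : 0 ≤ Function.leftLim G s := by
    rcases eq_or_ne s 0 with rfl | hs0
    · rw [leftLim_zero, h0]
    · exact h0 ▸ hG.le_leftLim (pos_iff_ne_zero.2 hs0)
  have hsub1 : Set.Ioo (Function.leftLim G s) (G s) ⊆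
      quantile G T ⁻¹' {s} ∩ Set.Ioc 0 (G T) := by
    rintro u ⟨h1, h2⟩
    have h4 : u ≤ G T := h2.le.trans (hG hs)
    refine ⟨le_antisymm ((quantile_le_iff hG hr h4).2 h2.le) ?_, hle.trans_lt h1, h4⟩
    by_contra! h
    have := (quantile_le_iff hG hr h4).1 le_rfl
    exact absurd (this.trans (hG.le_leftLim h)) (not_le.2 h1)
  have hsub2 : quantile G T ⁻¹' {s} ∩ Set.Ioc 0 (G T) ⊆
      Set.Icc (Function.leftLim G s) (G s) := by
    rintro u ⟨h1, h2, h3⟩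
    have h1 : quantile G T u = s := h1
    refine ⟨?_, (quantile_le_iff hG hr h3).1 h1.le⟩
    rcases eq_or_ne s 0 with rfl | hs0
    · rw [leftLim_zero, h0]; exact h2.le
    · refine leftLim_le_of_forall_lt hG (pos_iff_ne_zero.2 hs0) fun r hr' => ?_
      exact ((lt_quantile_iff hG hr h3).1 (h1 ▸ hr')).le
  have hvol : volume (quantile G T ⁻¹' {s} ∩ Set.Ioc 0 (G T)) =
      ENNReal.ofReal (G s - Function.leftLim G s) := by
    refine le_antisymm ?_ ?_
    · rw [← Real.volume_Icc]; exact measure_mono hsub2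
    · rw [← Real.volume_Ioo]; exact measure_mono hsub1
  rw [Measure.real, stieltjes, Measure.map_apply measurable_quantile (measurableSet_singleton s),
    Measure.restrict_apply (measurable_quantile (measurableSet_singleton s)), hvol,
    ENNReal.toReal_ofReal (sub_nonneg.2 (hG.leftLim_le le_rfl))]

lemma stieltjes_singleton_of_lt {s : ℝ≥0} (hs : T < s) : (stieltjes G T).real {s} = 0 := by
  rw [Measure.real, stieltjes, Measure.map_apply measurable_quantile (measurableSet_singleton s)]
  have : quantile G T ⁻¹' {s} = ∅ := by
    ext u
    simp only [Set.mem_preimage, Set.mem_singleton_iff, Set.mem_empty_iff_false, iff_false]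
    exact ((quantile_le u).trans_lt hs).ne
  simp [this]

end Quantile

/-! ### Weighted sums along partitions as integrals -/

/-- The step function whose integral is the weighted sum `∑ f t * a t`. -/
noncomputable def stepFun (P : Finset ℝ≥0) (a f : ℝ≥0 → ℝ) (T : ℝ≥0) (u : ℝ) : ℝ :=
  ∑ t ∈ P.filter (fun t => t ≤ T),
    (Set.Ioc (cumulLt P a t) (cumul P a t)).indicator (fun _ => f t) u

section StepFun
variable {P : Finset ℝ≥0} {a : ℝ≥0 → ℝ} {f : ℝ≥0 → ℝ} {T : ℝ≥0}

lemma measurable_stepFun : Measurable (stepFun P a f T) :=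
  Finset.measurable_sum _ fun _ _ => measurable_const.indicator measurableSet_Ioc

lemma integral_stepFun (ha : ∀ u, 0 ≤ a u) :
    ∫ u, stepFun P a f T u = ∑ t ∈ P.filter (fun t => t ≤ T), f t * a t := by
  unfold stepFun
  rw [integral_finsetSum]
  · refine Finset.sum_congr rfl fun t ht => ?_
    have htP := (Finset.mem_filter.1 ht).1
    rw [integral_indicator measurableSet_Ioc, setIntegral_const, Real.volume_real_Ioc,
      cumul_eq_cumulLt_add, if_pos htP, add_sub_cancel_left, max_eq_left (ha t), smul_eq_mul,
      mul_comm]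
  · intro t _
    refine (integrable_indicator_iff measurableSet_Ioc).2 ?_
    exact integrableOn_const (by simp) (by simp)

/-- The crossing point is the first partition point at which the cumulative sum reaches u. -/
lemma exists_bracket (h0 : 0 ∈ P) {u : ℝ} (hu : 0 < u) (hu' : u ≤ cumul P a T) :
    ∃ t ∈ P, t ≤ T ∧ cumulLt P a t < u ∧ u ≤ cumul P a t := by
  have hne : (P.filter (fun t => u ≤ cumul P a t ∧ t ≤ T)).Nonempty := by
    obtain ⟨t, ht, htT, -, hmax⟩ := exists_cell h0 T
    refine ⟨t, Finset.mem_filter.2 ⟨ht, ?_, htT⟩⟩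
    convert hu' using 1
    unfold cumul
    congr 1
    apply Finset.filter_congr
    exact fun v hv => ⟨fun h => h.trans htT, hmax v hv⟩
  set t := (P.filter (fun t => u ≤ cumul P a t ∧ t ≤ T)).min' hne with ht
  have hmem := Finset.min'_mem _ hne
  rw [← ht, Finset.mem_filter] at hmem
  refine ⟨t, hmem.1, hmem.2.2, ?_, hmem.2.1⟩
  rcases eq_or_ne t 0 with h | h
  · rw [h, cumulLt_zero]; exact hu
  · have hpos := pos_iff_ne_zero.2 h
    rw [← cumul_prev a hpos]
    by_contra! hcon
    have : t ≤ prev P t := Finset.min'_le _ _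
      (Finset.mem_filter.2 ⟨prev_mem h0 t, hcon, (prev_le P t).trans hmem.2.2⟩)
    exact absurd (prev_lt hpos) (not_lt.2 this)

lemma stepFun_eq (ha : ∀ u, 0 ≤ a u) {u : ℝ} {t : ℝ≥0} (ht : t ∈ P) (htT : t ≤ T)
    (h1 : cumulLt P a t < u) (h2 : u ≤ cumul P a t) : stepFun P a f T u = f t := by
  unfold stepFun
  rw [Finset.sum_eq_single_of_mem t (Finset.mem_filter.2 ⟨ht, htT⟩),
    Set.indicator_of_mem (Set.mem_Ioc.2 ⟨h1, h2⟩)]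
  intro s _ hst
  apply Set.indicator_of_notMem
  rintro ⟨h3, h4⟩
  rcases lt_or_gt_of_ne hst with h | h
  · linarith [cumul_le_cumulLt (P := P) ha h]
  · linarith [cumul_le_cumulLt (P := P) ha h]

lemma stepFun_eq_zero (ha : ∀ u, 0 ≤ a u) {u : ℝ} (hu : u ≤ 0 ∨ cumul P a T < u) :
    stepFun P a f T u = 0 := by
  unfold stepFun
  refine Finset.sum_eq_zero fun t ht => Set.indicator_of_notMem ?_ _
  rintro ⟨h1, h2⟩
  rcases hu with hu | hu
  · have : 0 ≤ cumulLt P a t := Finset.sum_nonneg fun v _ => ha v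
    linarith
  · linarith [cumul_mono (P := P) ha (Finset.mem_filter.1 ht).2]

end StepFun

/-- If the distribution functions of weights converge, then weighted sums converge to an integral
as soon as the summands, evaluated at quantiles, converge up to countably many levels. -/
theorem tendsto_sum_weighted {P : ℕ → Finset ℝ≥0} (hP : ∀ n, 0 ∈ P n) {a : ℕ → ℝ≥0 → ℝ}
    (ha : ∀ n u, 0 ≤ a n u) {G : ℝ≥0 → ℝ} {T : ℝ≥0}
    (hT : Tendsto (fun n => cumul (P n) (a n) T) atTop (𝓝 (G T)))
    {f : ℕ → ℝ≥0 → ℝ} {K : ℝ} (hK : ∀ᶠ n in atTop, ∀ t ∈ P n, t ≤ T → |f n t| ≤ K)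
    {ψ : ℝ≥0 → ℝ} (hψ : Measurable ψ) {E : Set ℝ} (hE : E.Countable)
    (h : ∀ u, 0 < u → u < G T → u ∉ E → ∀ s : ℕ → ℝ≥0,
      (∀ᶠ n in atTop, s n ∈ P n ∧ s n ≤ T ∧ cumulLt (P n) (a n) (s n) < u ∧
        u ≤ cumul (P n) (a n) (s n)) →
      Tendsto (fun n => f n (s n)) atTop (𝓝 (ψ (quantile G T u)))) :
    Integrable ψ (stieltjes G T) ∧
    Tendsto (fun n => ∑ t ∈ (P n).filter (fun t => t ≤ T), f n t * a n t) atTop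
      (𝓝 (∫ t, ψ t ∂stieltjes G T)) := by
  classical
  -- The total mass of the n-th sum is only eventually below G T + 1, hence the margin in the
  -- dominating function.
  set bound : ℝ → ℝ := (Set.Ioc 0 (G T + 1)).indicator (fun _ => |K|) with hbound
  set Ψ : ℝ → ℝ := (Set.Ioc 0 (G T)).indicator (fun u => ψ (quantile G T u)) with hΨ
  have hb_int : Integrable bound := by
    refine (integrable_indicator_iff measurableSet_Ioc).2 ?_
    exact integrableOn_const (by simp) (by simp)
  have hb_nonneg : ∀ u, 0 ≤ bound u := fun u => Set.indicator_nonneg (fun _ _ => abs_nonneg K) u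
  have hle : ∀ᶠ n in atTop, ∀ᵐ u, ‖stepFun (P n) (a n) (f n) T u‖ ≤ bound u := by
    filter_upwards [hK, hT.eventually_lt_const (show G T < G T + 1 by simp)] with n h1 h2
    refine .of_forall fun u => ?_
    by_cases hu : 0 < u ∧ u ≤ cumul (P n) (a n) T
    · obtain ⟨t, ht, htT, h3, h4⟩ := exists_bracket (hP n) hu.1 hu.2
      rw [stepFun_eq (ha n) ht htT h3 h4, hbound,
        Set.indicator_of_mem (Set.mem_Ioc.2 ⟨hu.1, hu.2.trans h2.le⟩)]
      exact (h1 t ht htT).trans (le_abs_self K)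
    · rw [stepFun_eq_zero (ha n) (by by_contra! hcon; exact hu hcon), norm_zero]
      exact hb_nonneg u
  have hlim : ∀ᵐ u, Tendsto (fun n => stepFun (P n) (a n) (f n) T u) atTop (𝓝 (Ψ u)) := by
    have hE' : (E ∪ {G T}).Countable := hE.union (Set.countable_singleton _)
    filter_upwards [hE'.ae_notMem volume] with u hu
    rw [Set.mem_union, not_or] at hu
    rcases le_or_gt u 0 with h0 | h0
    · rw [hΨ, Set.indicator_of_notMem (fun h' => absurd h'.1 (not_lt.2 h0))]
      refine tendsto_const_nhds.congr fun n => ?_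
      rw [stepFun_eq_zero (ha n) (Or.inl h0)]
    rcases lt_or_gt_of_ne (show u ≠ G T from hu.2) with h1 | h1
    · rw [hΨ, Set.indicator_of_mem (Set.mem_Ioc.2 ⟨h0, h1.le⟩)]
      let s : ℕ → ℝ≥0 := fun n => if hn : u ≤ cumul (P n) (a n) T
        then (exists_bracket (hP n) h0 hn).choose else 0
      have hs : ∀ᶠ n in atTop, s n ∈ P n ∧ s n ≤ T ∧ cumulLt (P n) (a n) (s n) < u ∧
          u ≤ cumul (P n) (a n) (s n) := by
        filter_upwards [hT.eventually_const_lt h1] with n hn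
        simp only [s, dif_pos hn.le]
        exact (exists_bracket (hP n) h0 hn.le).choose_spec
      refine (h u h0 h1 hu.1 s hs).congr' ?_
      filter_upwards [hs] with n hn
      rw [stepFun_eq (ha n) hn.1 hn.2.1 hn.2.2.1 hn.2.2.2]
    · rw [hΨ, Set.indicator_of_notMem (fun h' => absurd h'.2 (not_le.2 h1))]
      refine tendsto_const_nhds.congr' ?_
      filter_upwards [hT.eventually_lt_const h1] with n hn
      rw [stepFun_eq_zero (ha n) (Or.inr hn)]
  have hΨm : Measurable Ψ := (hψ.comp measurable_quantile).indicator measurableSet_Ioc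
  have hΨi : Integrable Ψ := by
    refine hb_int.mono' hΨm.aestronglyMeasurable ?_
    -- The indices form a countable set, so the exceptional null sets can be united and the bound
    -- passes to the limit.
    have hall : ∀ᵐ u, ∀ᶠ n in atTop, ‖stepFun (P n) (a n) (f n) T u‖ ≤ bound u := by
      obtain ⟨N, hN⟩ := eventually_atTop.1 hle
      have := ae_all_iff.2 fun k : ℕ => hN (N + k) (Nat.le_add_right _ _)
      filter_upwards [this] with u hu
      refine eventually_atTop.2 ⟨N, fun n hn => ?_⟩
      obtain ⟨k, rfl⟩ := Nat.exists_eq_add_of_le hn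
      exact hu k
    filter_upwards [hlim, hall] with u h1 h2
    exact le_of_tendsto h1.norm h2
  have hint : Integrable (fun u => ψ (quantile G T u)) (volume.restrict (Set.Ioc 0 (G T))) :=
    (integrable_indicator_iff measurableSet_Ioc).1 hΨi
  refine ⟨(integrable_map_measure hψ.aestronglyMeasurable
    measurable_quantile.aemeasurable).2 hint, ?_⟩
  have hmain := tendsto_integral_filter_of_dominated_convergence bound
    (.of_forall fun n => measurable_stepFun.aestronglyMeasurable) hle hb_int hlim
  simp only [integral_stepFun (ha _)] at hmain
  rw [stieltjes, integral_map measurable_quantile.aemeasurable hψ.aestronglyMeasurable]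
  rwa [hΨ, integral_indicator measurableSet_Ioc] at hmain

/-! ### Nonnegative weights with a Skorokhod limit -/

/-- The sums of the nonnegative weights `b(x(tᵢ₊₁) - x(tᵢ))` converge to the càdlàg function `G`
in the Skorokhod topology. -/
structure WeightLimit (π : PartitionSeq) (x : Traj m) (b : EuclideanSpace ℝ (Fin m) → ℝ)
    (G : ℝ≥0 → ℝ) : Prop where
  path : IsCadlag x
  cont : Continuous b
  zero : b 0 = 0
  nonneg : ∀ d, 0 ≤ b d
  limit : IsCadlag G
  skorokhod : SkorokhodTendsto (fun n => cumul (π.pts n) (weight (π.pts n) x b)) G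

section
variable {π : PartitionSeq} {x : Traj m} {b : EuclideanSpace ℝ (Fin m) → ℝ} {G : ℝ≥0 → ℝ}
  {T : ℝ≥0}

lemma WeightLimit.weight_nonneg (W : WeightLimit π x b G) (n : ℕ) (u : ℝ≥0) :
    0 ≤ weight (π.pts n) x b u := W.nonneg _

lemma WeightLimit.tendsto_cumul (W : WeightLimit π x b G) (t : ℝ≥0) :
    Tendsto (fun n => cumul (π.pts n) (weight (π.pts n) x b) t) atTop (𝓝 (G t)) :=
  skorokhod_tendsto_cumul_all π b W.path W.cont W.zero W.limit W.skorokhod t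

lemma WeightLimit.tendsto_cumulLt (W : WeightLimit π x b G) {t : ℝ≥0} (ht : 0 < t) :
    Tendsto (fun n => cumulLt (π.pts n) (weight (π.pts n) x b) t) atTop (𝓝 (G t)) :=
  (skorokhod_tendsto_cumul π b W.path W.cont W.zero W.limit W.skorokhod ht).2.1

lemma WeightLimit.tendsto_cumulLt_prev (W : WeightLimit π x b G) {t : ℝ≥0} (ht : 0 < t) :
    Tendsto (fun n => cumulLt (π.pts n) (weight (π.pts n) x b) (prev (π.pts n) t)) atTop
      (𝓝 (Function.leftLim G t)) :=
  (skorokhod_tendsto_cumul π b W.path W.cont W.zero W.limit W.skorokhod ht).2.2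

lemma WeightLimit.mono (W : WeightLimit π x b G) : Monotone G := fun s t h =>
  le_of_tendsto_of_tendsto' (W.tendsto_cumul s) (W.tendsto_cumul t) fun n =>
    cumul_mono (W.weight_nonneg n) h

lemma WeightLimit.apply_zero (W : WeightLimit π x b G) : G 0 = 0 :=
  skorokhod_limit_zero π b W.path W.cont W.zero W.skorokhod

lemma WeightLimit.jump_eq (W : WeightLimit π x b G) (t : ℝ≥0) :
    G t - Function.leftLim G t = b (jump x t) :=
  skorokhod_limit_jump π b W.path W.cont W.zero W.limit W.skorokhod t

lemma WeightLimit.stieltjes_Ioc (W : WeightLimit π x b G) {s : ℝ≥0} (hs : s ≤ T) :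
    (stieltjes G T).real (Set.Ioc 0 s) = G s :=
  CausalCalculus.stieltjes_Ioc W.mono (fun t => (W.limit t).1) W.apply_zero hs

lemma WeightLimit.stieltjes_singleton (W : WeightLimit π x b G) {s : ℝ≥0} (hs : s ≤ T) :
    (stieltjes G T).real {s} = b (jump x s) := by
  rw [CausalCalculus.stieltjes_singleton W.mono (fun t => (W.limit t).1) W.apply_zero hs, W.jump_eq]

/-- At all but countably many levels `u`, partition points where the sums cross the level `u`
converge to the quantile of the limit at `u`. -/
lemma WeightLimit.tendsto_quantile (W : WeightLimit π x b G) {D : Set ℝ≥0} (hD : Dense D) {u : ℝ}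
    (hu : u < G T) (huD : u ∉ G '' D) {s : ℕ → ℝ≥0}
    (hs : ∀ᶠ n in atTop, cumulLt (π.pts n) (weight (π.pts n) x b) (s n) < u ∧
        u ≤ cumul (π.pts n) (weight (π.pts n) x b) (s n)) :
    Tendsto s atTop (𝓝 (quantile G T u)) := by
  have hr := fun t => (W.limit t).1
  rw [tendsto_order]
  refine ⟨fun r h => ?_, fun r h => ?_⟩
  · have h1 := (lt_quantile_iff W.mono hr hu.le).1 h
    filter_upwards [hs, (W.tendsto_cumul r).eventually_lt_const h1] with n h2 h3
    by_contra! hcon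
    linarith [cumul_mono (P := π.pts n) (W.weight_nonneg n) hcon]
  · obtain ⟨ρ, hρD, hρ, hρr⟩ := hD.exists_between h
    have h1 : u < G ρ := lt_of_le_of_ne
      ((quantile_le_iff W.mono hr hu.le).1 hρ.le) fun h => huD ⟨ρ, hρD, h.symm⟩
    filter_upwards [hs, (W.tendsto_cumul ρ).eventually_const_lt h1] with n h2 h3
    refine lt_of_le_of_lt ?_ hρr
    by_contra! hcon
    linarith [cumul_le_cumulLt (P := π.pts n) (W.weight_nonneg n) hcon]

/-- The sums strictly before t converge to G t, including the jump at t, so the level u is already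
exceeded before t. -/
lemma WeightLimit.eventually_le_prev (W : WeightLimit π x b G) {t : ℝ≥0} (ht : 0 < t) {u : ℝ}
    (hu : u < G t) {s : ℕ → ℝ≥0}
    (hs : ∀ᶠ n in atTop, s n ∈ π.pts n ∧ cumulLt (π.pts n) (weight (π.pts n) x b) (s n) < u) :
    ∀ᶠ n in atTop, s n ≤ prev (π.pts n) t := by
  filter_upwards [hs, (W.tendsto_cumulLt ht).eventually_const_lt hu] with n h1 h2
  refine le_prev h1.1 ?_
  by_contra! hcon
  linarith [cumulLt_mono (P := π.pts n) (W.weight_nonneg n) hcon]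

/-- The sums strictly before the partition point preceding t converge to G(t-), so they have not yet
reached u. -/
lemma WeightLimit.eventually_prev_le (W : WeightLimit π x b G) {t : ℝ≥0} (ht : 0 < t) {u : ℝ}
    (hu : Function.leftLim G t < u) {s : ℕ → ℝ≥0}
    (hs : ∀ᶠ n in atTop, u ≤ cumul (π.pts n) (weight (π.pts n) x b) (s n)) :
    ∀ᶠ n in atTop, prev (π.pts n) t ≤ s n := by
  filter_upwards [hs, (W.tendsto_cumulLt_prev ht).eventually_lt_const hu] with n h1 h2
  by_contra! hcon
  linarith [cumul_le_cumulLt (P := π.pts n) (W.weight_nonneg n) hcon]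

lemma WeightLimit.quantile_pos (W : WeightLimit π x b G) {u : ℝ} (h0 : 0 < u) (hu : u < G T) :
    0 < quantile G T u :=
  (lt_quantile_iff W.mono (fun t => (W.limit t).1) hu.le).2 (by rwa [W.apply_zero])

lemma WeightLimit.le_apply_quantile (W : WeightLimit π x b G) {u : ℝ} (hu : u < G T) :
    u ≤ G (quantile G T u) :=
  (quantile_le_iff W.mono (fun t => (W.limit t).1) hu.le).1 le_rfl

lemma WeightLimit.leftLim_quantile_le (W : WeightLimit π x b G) {u : ℝ} (h0 : 0 < u)
    (hu : u < G T) : Function.leftLim G (quantile G T u) ≤ u :=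
  leftLim_le_of_forall_lt W.mono (W.quantile_pos h0 hu) fun _ hr =>
    ((lt_quantile_iff W.mono (fun t => (W.limit t).1) hu.le).1 hr).le

/-- Weighted sums of functions that converge from the left converge to a Stieltjes integral. -/
theorem WeightLimit.tendsto_sum_of_convergesLeft (W : WeightLimit π x b G)
    {h : ℕ → ℝ≥0 → ℝ} {H : ℝ≥0 → ℝ} (hc : ConvergesLeft π h H) (hH : Measurable H) {K : ℝ}
    (hK : ∀ᶠ n in atTop, ∀ t ∈ π.pts n, t ≤ T → |h n t| ≤ K) :
    Integrable H (stieltjes G T) ∧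
    Tendsto (fun n => ∑ t ∈ (π.pts n).filter (fun t => t ≤ T), h n t * weight (π.pts n) x b t)
      atTop (𝓝 (∫ t, H t ∂stieltjes G T)) := by
  obtain ⟨D, hDc, hD⟩ := TopologicalSpace.exists_countable_dense ℝ≥0
  refine tendsto_sum_weighted π.zero_mem W.weight_nonneg (W.tendsto_cumul T) hK hH
    (E := G '' D ∪ G '' {t | ¬ConvergesAt h H t})
    ((hDc.image G).union (hc.countable.image G)) fun u h0 hu huE s hs => ?_
  rw [Set.mem_union, not_or] at huE
  have hlim := W.tendsto_quantile hD hu huE.1 (hs.mono fun n hn => hn.2.2)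
  -- A level strictly below G at the quantile puts the crossing points on the admissible side. At
  -- equality the side is unknown, but the excluded levels rule out times without two-sided
  -- convergence.
  rcases (W.le_apply_quantile hu).lt_or_eq with h1 | h1
  · exact hc _ s hlim (W.eventually_le_prev (W.quantile_pos h0 hu) h1
      (hs.mono fun n hn => ⟨hn.1, hn.2.2.1⟩))
  · have : ConvergesAt h H (quantile G T u) := by
      by_contra hcon
      exact huE.2 ⟨_, hcon, h1.symm⟩
    exact this s hlim

/-- A jump of x makes G jump by b(Δx) ≠ 0, and a monotone function has countably many
discontinuities. -/
lemma WeightLimit.countable_jumps (W : WeightLimit π x b G) (hb : ∀ d, b d = 0 → d = 0) :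
    {t | jump x t ≠ 0}.Countable := by
  refine Set.Countable.mono ?_ W.mono.countable_not_continuousAt
  intro t ht hc
  refine ht (hb _ ?_)
  rw [← W.jump_eq, sub_eq_zero]
  rcases eq_or_ne t 0 with rfl | h0
  · rw [leftLim_zero]
  · have := nhdsLT_neBot (pos_iff_ne_zero.2 h0)
    exact (leftLim_eq_of_tendsto (hc.tendsto.mono_left nhdsWithin_le_nhds)).symm

/-- Weighted sums of functions that vanish in the limit away from the jumps of the path. -/
theorem WeightLimit.tendsto_sum_jumps (W : WeightLimit π x b G) (hb : ∀ d, b d = 0 → d = 0)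
    {f : ℕ → ℝ≥0 → ℝ} {ψ : ℝ≥0 → ℝ} {K : ℝ}
    (hK : ∀ᶠ n in atTop, ∀ t ∈ π.pts n, t ≤ T → |f n t| ≤ K)
    (hψ : ∀ t, jump x t = 0 → ψ t = 0)
    (hjump : ∀ t, 0 < t → t ≤ T → jump x t ≠ 0 →
      Tendsto (fun n => f n (prev (π.pts n) t)) atTop (𝓝 (ψ t)))
    (hcont : ∀ t, 0 < t → t ≤ T → jump x t = 0 → ∀ s : ℕ → ℝ≥0, Tendsto s atTop (𝓝 t) →
      (∀ᶠ n in atTop, s n ∈ π.pts n ∧ s n ≤ T) → Tendsto (fun n => f n (s n)) atTop (𝓝 0)) :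
    Integrable ψ (stieltjes G T) ∧
    Tendsto (fun n => ∑ t ∈ (π.pts n).filter (fun t => t ≤ T), f n t * weight (π.pts n) x b t)
      atTop (𝓝 (∫ t, ψ t ∂stieltjes G T)) := by
  have hA := W.countable_jumps hb
  obtain ⟨D, hDc, hD⟩ := TopologicalSpace.exists_countable_dense ℝ≥0
  have hψm : Measurable ψ := by
    refine Measurable.measurable_of_countable_ne (measurable_const (a := (0 : ℝ)))
      (hA.mono fun t ht h0 => ht (hψ t h0).symm)
  refine tendsto_sum_weighted π.zero_mem W.weight_nonneg (W.tendsto_cumul T) hK hψm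
    (E := G '' D ∪ (G '' {t | jump x t ≠ 0} ∪ Function.leftLim G '' {t | jump x t ≠ 0}))
    ((hDc.image G).union ((hA.image _).union (hA.image _))) fun u h0 hu huE s hs => ?_
  simp only [Set.mem_union, not_or] at huE
  obtain ⟨hE1, hE2, hE3⟩ := huE
  have hlim := W.tendsto_quantile hD hu hE1 (hs.mono fun n hn => hn.2.2)
  have hpos := W.quantile_pos h0 hu
  by_cases hj : jump x (quantile G T u) = 0
  · rw [hψ _ hj]
    exact hcont _ hpos (quantile_le u) hj s hlim (hs.mono fun n hn => ⟨hn.1, hn.2.1⟩)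
  -- The end levels G(t-) and G(t) of each jump are excluded, so u lies strictly inside the jump.
  -- This pins the crossing points to the partition point preceding t.
  · have h1 : u < G (quantile G T u) := lt_of_le_of_ne (W.le_apply_quantile hu)
      fun h => hE2 ⟨_, hj, h.symm⟩
    have h2 : Function.leftLim G (quantile G T u) < u := lt_of_le_of_ne
      (W.leftLim_quantile_le h0 hu) fun h => hE3 ⟨_, hj, h⟩
    refine (hjump _ hpos (quantile_le u) hj).congr' ?_
    filter_upwards [W.eventually_le_prev hpos h1 (hs.mono fun n hn => ⟨hn.1, hn.2.2.1⟩),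
      W.eventually_prev_le hpos h2 (hs.mono fun n hn => hn.2.2.2)] with n h3 h4
    rw [le_antisymm h3 h4]

/-- Splitting an integral into its continuous part and the sum over the jumps. -/
lemma WeightLimit.integral_eq (W : WeightLimit π x b G) (hA : {t | jump x t ≠ 0}.Countable)
    {f : ℝ≥0 → ℝ} (hf : Integrable f (stieltjes G T)) :
    HasSum (fun s : Set.Iic T => f s * b (jump x s))
      (∫ t, f t ∂stieltjes G T - ∫ t in {t | jump x t ≠ 0}ᶜ, f t ∂stieltjes G T) := by
  set A := {t | jump x t ≠ 0} with hAdef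
  have hAm : MeasurableSet A := hA.measurableSet
  rw [← integral_add_compl hAm hf, add_sub_cancel_right]
  have : Countable A := hA.to_subtype
  have h1 := hasSum_integral_iUnion (μ := stieltjes G T) (f := f) (s := fun a : A => {(a : ℝ≥0)})
    (fun a => measurableSet_singleton _) (fun a a' h => by
      simpa [Function.onFun] using fun h' => h (Subtype.ext h')) hf.integrableOn
  rw [Set.iUnion_singleton_eq_range, Subtype.range_coe] at h1
  simp only [integral_singleton] at h1
  have h2 : HasSum (A.indicator fun a => (stieltjes G T).real {a} • f a)
      (∫ t in A, f t ∂stieltjes G T) := (hasSum_subtype_iff_indicator).1 h1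
  refine (hasSum_subtype_iff_indicator (f := fun s => f s * b (jump x s))).2 ?_
  convert h2 using 1
  ext s
  by_cases hs : s ∈ A
  · rw [Set.indicator_of_mem hs]
    by_cases hsT : s ≤ T
    · rw [Set.indicator_of_mem (Set.mem_Iic.2 hsT), W.stieltjes_singleton hsT, smul_eq_mul,
        mul_comm]
    · rw [Set.indicator_of_notMem (by simpa using hsT),
        stieltjes_singleton_of_lt (not_le.1 hsT), zero_smul]
  · rw [Set.indicator_of_notMem hs]
    have : jump x s = 0 := by by_contra h; exact hs h
    simp [Set.indicator, this, W.zero]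

/-- The jumps `b(Δx(s))` are summable, and removing them from `G` leaves the distribution function
of the continuous part of the measure. -/
lemma WeightLimit.hasSum_jumps (W : WeightLimit π x b G) (hA : {t | jump x t ≠ 0}.Countable)
    {s : ℝ≥0} (hs : s ≤ T) :
    HasSum (fun r : Set.Iic s => b (jump x r))
      (G s - ((stieltjes G T).restrict {t | jump x t ≠ 0}ᶜ).real (Set.Ioc 0 s)) := by
  have hf : Integrable ((Set.Ioc 0 s).indicator fun _ => (1 : ℝ)) (stieltjes G T) :=
    (integrable_const 1).indicator measurableSet_Ioc
  have h1 := W.integral_eq hA hf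
  rw [integral_indicator_const _ measurableSet_Ioc, integral_indicator_const _ measurableSet_Ioc,
    W.stieltjes_Ioc hs, smul_eq_mul, mul_one, smul_eq_mul, mul_one] at h1
  refine (hasSum_subtype_iff_indicator (f := fun r => b (jump x r))).2 ?_
  convert (hasSum_subtype_iff_indicator
    (f := fun r => (Set.Ioc 0 s).indicator (fun _ => (1 : ℝ)) r * b (jump x r))).1 h1 using 1
  ext r
  rcases eq_or_ne r 0 with rfl | h0
  · simp [Set.indicator, jump_zero, W.zero]
  · have := pos_iff_ne_zero.2 h0
    by_cases hr : r ≤ s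
    · simp [Set.indicator, hr, hr.trans hs, this]
    · simp [Set.indicator, hr]

end

/-! ### Weights from the quadratic variation -/

/-- Uniform continuity transfers Skorokhod convergence of the matrix sums to linear combinations of
entries, with the same time changes. -/
lemma uniformContinuous_entries (c : Matrix (Fin m) (Fin m) ℝ) :
    UniformContinuous fun M : Matrix (Fin m) (Fin m) ℝ => ∑ i, ∑ j, c i j * M i j := by
  have h : ∀ i j, UniformContinuous fun M : Matrix (Fin m) (Fin m) ℝ => c i j * M i j := by
    intro i j
    have h1 : UniformContinuous fun M : Fin m → Fin m → ℝ => M i :=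
      Pi.uniformContinuous_proj (fun _ : Fin m => Fin m → ℝ) i
    have h2 : UniformContinuous fun M : Fin m → ℝ => M j :=
      Pi.uniformContinuous_proj (fun _ : Fin m => ℝ) j
    exact (h2.comp h1).const_smul (c i j)
  have hsum : ∀ {ι : Type} (s : Finset ι) (f : ι → Matrix (Fin m) (Fin m) ℝ → ℝ),
      (∀ i, UniformContinuous (f i)) → UniformContinuous fun M => ∑ i ∈ s, f i M := by
    classical
    intro ι s f hf
    induction s using Finset.induction_on with
    | empty => simpa using uniformContinuous_const
    | insert a s ha ih =>
      simp only [Finset.sum_insert ha]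
      exact (hf a).add ih
  exact hsum _ _ fun i => hsum _ _ fun j => h i j

lemma HasQuadVar.isCadlag_entries {π : PartitionSeq} {x : Traj m}
    {q : ℝ≥0 → Matrix (Fin m) (Fin m) ℝ} (hq : HasQuadVar π x q) (c : Matrix (Fin m) (Fin m) ℝ) :
    IsCadlag fun t => ∑ i, ∑ j, c i j * q t i j := by
  have hL := (uniformContinuous_entries c).continuous
  refine fun t => ⟨hL.continuousAt.comp_continuousWithinAt (hq.1 t).1, ?_⟩
  obtain ⟨l, hl⟩ := (hq.1 t).2
  exact ⟨_, (hL.tendsto l).comp hl⟩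

lemma HasQuadVar.skorokhodTendsto {π : PartitionSeq} {x : Traj m}
    {q : ℝ≥0 → Matrix (Fin m) (Fin m) ℝ} (hq : HasQuadVar π x q)
    {b : EuclideanSpace ℝ (Fin m) → ℝ} (c : Matrix (Fin m) (Fin m) ℝ)
    (hbc : ∀ d, b d = ∑ i, ∑ j, c i j * (d i * d j)) :
    SkorokhodTendsto (fun n => cumul (π.pts n) (weight (π.pts n) x b))
      fun t => ∑ i, ∑ j, c i j * q t i j := by
  obtain ⟨lam, h1, h2⟩ := hq.2
  refine ⟨lam, h1, fun N => ?_⟩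
  convert (uniformContinuous_entries c).comp_tendstoUniformlyOn (h2 N) using 2 with n
  ext s
  simp only [Function.comp, cumul, weight, hbc, qvSum, Matrix.of_apply, Finset.mul_sum]
  rw [Finset.sum_comm]
  refine Finset.sum_congr rfl fun i _ => ?_
  rw [Finset.sum_comm]
  simp

lemma HasQuadVar.weightLimit {π : PartitionSeq} {x : Traj m}
    {q : ℝ≥0 → Matrix (Fin m) (Fin m) ℝ} (hx : IsCadlag x) (hq : HasQuadVar π x q)
    {b : EuclideanSpace ℝ (Fin m) → ℝ} (hb : ∀ d, 0 ≤ b d) (c : Matrix (Fin m) (Fin m) ℝ)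
    (hbc : ∀ d, b d = ∑ i, ∑ j, c i j * (d i * d j)) :
    WeightLimit π x b fun t => ∑ i, ∑ j, c i j * q t i j :=
  ⟨hx, by rw [funext hbc]; fun_prop, by simp [hbc], hb, hq.isCadlag_entries c,
    hq.skorokhodTendsto c hbc⟩

/-- The bilinear form `(dᵢ + σ dⱼ)² / 4`, used to polarize `dᵢ dⱼ`. -/
noncomputable def polar (σ : ℝ) (i j : Fin m) (d : EuclideanSpace ℝ (Fin m)) : ℝ :=
  (d i + σ * d j) ^ 2 / 4

/-- The matrix of the quadratic form `polar σ i j`. -/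
noncomputable def polarMatrix (σ : ℝ) (i j : Fin m) : Matrix (Fin m) (Fin m) ℝ :=
  Matrix.of fun k l => ((if k = i then 1 else 0) + σ * (if k = j then 1 else 0)) *
    ((if l = i then 1 else 0) + σ * (if l = j then 1 else 0)) / 4

lemma polar_eq (σ : ℝ) (i j : Fin m) (d : EuclideanSpace ℝ (Fin m)) :
    polar σ i j d = ∑ k, ∑ l, polarMatrix σ i j k l * (d k * d l) := by
  have h : ∑ k, ((if k = i then 1 else 0) + σ * (if k = j then 1 else 0)) * d k =
      d i + σ * d j := by
    simp [add_mul, Finset.sum_add_distrib]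
  rw [polar, ← h, sq, Finset.sum_mul_sum, Finset.sum_div]
  refine Finset.sum_congr rfl fun k _ => ?_
  rw [Finset.sum_div]
  refine Finset.sum_congr rfl fun l _ => ?_
  simp only [polarMatrix, Matrix.of_apply]
  ring

lemma polar_sub_polar (i j : Fin m) (d : EuclideanSpace ℝ (Fin m)) :
    polar 1 i j d - polar (-1) i j d = d i * d j := by
  unfold polar; ring

lemma norm_sq_eq_sum (d : EuclideanSpace ℝ (Fin m)) :
    ‖d‖ ^ 2 = ∑ i, ∑ j, (1 : Matrix (Fin m) (Fin m) ℝ) i j * (d i * d j) := by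
  rw [EuclideanSpace.norm_sq_eq]
  simp [Matrix.one_apply, sq]

section
variable {π : PartitionSeq} {x : Traj m} {q : ℝ≥0 → Matrix (Fin m) (Fin m) ℝ}

/-- The limit of the sums of the weights `polar σ i j`. -/
noncomputable def polarLimit (q : ℝ≥0 → Matrix (Fin m) (Fin m) ℝ) (σ : ℝ) (i j : Fin m)
    (t : ℝ≥0) : ℝ := ∑ k, ∑ l, polarMatrix σ i j k l * q t k l

/-- The trace of a matrix path. -/
noncomputable def traceLimit (q : ℝ≥0 → Matrix (Fin m) (Fin m) ℝ) (t : ℝ≥0) : ℝ :=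
  ∑ k, ∑ l, (1 : Matrix (Fin m) (Fin m) ℝ) k l * q t k l

lemma HasQuadVar.weightLimit_polar (hx : IsCadlag x) (hq : HasQuadVar π x q) (σ : ℝ) (i j : Fin m) :
    WeightLimit π x (polar σ i j) (polarLimit q σ i j) :=
  hq.weightLimit hx (fun d => by unfold polar; positivity) _ (polar_eq σ i j)

lemma HasQuadVar.weightLimit_trace (hx : IsCadlag x) (hq : HasQuadVar π x q) :
    WeightLimit π x (fun d => ‖d‖ ^ 2) (traceLimit q) :=
  hq.weightLimit hx (fun d => by positivity) _ norm_sq_eq_sum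

lemma HasQuadVar.countable_jumps (hx : IsCadlag x) (hq : HasQuadVar π x q) :
    {t | jump x t ≠ 0}.Countable :=
  (hq.weightLimit_trace hx).countable_jumps fun d hd => by simpa using hd

/-- The weight dᵢdⱼ has no sign, but pointwise convergence of its sums needs none. Both sides are
limits of the same sums. -/
lemma HasQuadVar.entry_eq (hx : IsCadlag x) (hq : HasQuadVar π x q) (t : ℝ≥0) (i j : Fin m) :
    q t i j = polarLimit q 1 i j t - polarLimit q (-1) i j t := by
  have hc : ∀ d : EuclideanSpace ℝ (Fin m), d i * d j =
      ∑ k, ∑ l, (Matrix.single i j 1 : Matrix (Fin m) (Fin m) ℝ) k l * (d k * d l) := by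
    intro d
    simp [Matrix.single_apply, ite_and]
  have h := skorokhod_tendsto_cumul_all π (fun d : EuclideanSpace ℝ (Fin m) => d i * d j) hx
    (by fun_prop) (by simp) (hq.isCadlag_entries _) (hq.skorokhodTendsto _ hc) t
  have h' := ((hq.weightLimit_polar hx 1 i j).tendsto_cumul t).sub
    ((hq.weightLimit_polar hx (-1) i j).tendsto_cumul t)
  have e : ∑ k, ∑ l, (Matrix.single i j 1 : Matrix (Fin m) (Fin m) ℝ) k l * q t k l = q t i j := by
    simp [Matrix.single_apply, ite_and]
  rw [e] at h
  refine tendsto_nhds_unique h (h'.congr fun n => ?_)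
  simp only [cumul, weight, ← Finset.sum_sub_distrib, polar_sub_polar]

end

/-! ### Measurability of one-sided continuous functions -/

/-- f is the pointwise limit of its values at the next grid point to the right, and these depend on
t through an integer only. -/
lemma measurable_of_rightCts {f : ℝ≥0 → ℝ} (h : ∀ t, Tendsto f (𝓝[≥] t) (𝓝 (f t))) :
    Measurable f := by
  have hm : ∀ n : ℕ, Measurable fun t : ℝ≥0 =>
      f (((⌊((n : ℝ≥0) + 1) * t⌋₊ : ℝ≥0) + 1) / ((n : ℝ≥0) + 1)) := fun n =>
    (measurable_from_top (f := fun k : ℕ => f (((k : ℝ≥0) + 1) / ((n : ℝ≥0) + 1)))).comp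
      (Nat.measurable_floor.comp (measurable_const.mul measurable_id))
  refine measurable_of_tendsto_metrizable hm (tendsto_pi_nhds.2 fun t => (h t).comp ?_)
  have hge : ∀ n : ℕ, t ≤ ((⌊((n : ℝ≥0) + 1) * t⌋₊ : ℝ≥0) + 1) / ((n : ℝ≥0) + 1) := fun n => by
    rw [le_div_iff₀ (by positivity), mul_comm]
    exact (Nat.lt_floor_add_one _).le
  refine tendsto_nhdsWithin_iff.2 ⟨?_, .of_forall hge⟩
  have hlim : Tendsto (fun n : ℕ => t + 1 / ((n : ℝ≥0) + 1)) atTop (𝓝 t) := by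
    have h0 : Tendsto (fun n : ℕ => 1 / ((n : ℝ≥0) + 1)) atTop (𝓝 0) :=
      tendsto_one_div_add_atTop_nhds_zero_nat
    simpa using tendsto_const_nhds.add h0
  refine tendsto_of_tendsto_of_tendsto_of_le_of_le tendsto_const_nhds hlim hge fun n => ?_
  show _ ≤ t + 1 / ((n : ℝ≥0) + 1)
  rw [add_div]
  gcongr
  rw [div_le_iff₀ (by positivity), mul_comm t]
  exact Nat.floor_le zero_le

/-- The grid point is now taken to the left. Truncated subtraction keeps it at 0 for t = 0. -/
lemma measurable_of_leftCts {f : ℝ≥0 → ℝ} (h : ∀ t, Tendsto f (𝓝[≤] t) (𝓝 (f t))) :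
    Measurable f := by
  have hm : ∀ n : ℕ, Measurable fun t : ℝ≥0 =>
      f (((⌈((n : ℝ≥0) + 1) * t⌉₊ : ℝ≥0) - 1) / ((n : ℝ≥0) + 1)) := fun n =>
    (measurable_from_top (f := fun k : ℕ => f (((k : ℝ≥0) - 1) / ((n : ℝ≥0) + 1)))).comp
      (Nat.measurable_ceil.comp (measurable_const.mul measurable_id))
  refine measurable_of_tendsto_metrizable hm (tendsto_pi_nhds.2 fun t => (h t).comp ?_)
  have hle : ∀ n : ℕ, ((⌈((n : ℝ≥0) + 1) * t⌉₊ : ℝ≥0) - 1) / ((n : ℝ≥0) + 1) ≤ t := fun n => by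
    rw [div_le_iff₀ (by positivity), mul_comm t, tsub_le_iff_right]
    exact (Nat.ceil_lt_add_one zero_le).le
  refine tendsto_nhdsWithin_iff.2 ⟨?_, .of_forall hle⟩
  have hlim : Tendsto (fun n : ℕ => t - 1 / ((n : ℝ≥0) + 1)) atTop (𝓝 t) := by
    have h0 : Tendsto (fun n : ℕ => 1 / ((n : ℝ≥0) + 1)) atTop (𝓝 0) :=
      tendsto_one_div_add_atTop_nhds_zero_nat
    simpa using (tendsto_const_nhds (x := t)).sub h0
  refine tendsto_of_tendsto_of_tendsto_of_le_of_le hlim tendsto_const_nhds (fun n => ?_) hle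
  show t - 1 / ((n : ℝ≥0) + 1) ≤ _
  have hpos : (0 : ℝ≥0) < (n : ℝ≥0) + 1 := by positivity
  rw [le_div_iff₀ hpos, tsub_mul, div_mul_cancel₀ _ hpos.ne', mul_comm t]
  exact tsub_le_tsub_right (Nat.le_ceil _) _

/-! ### Second-order expansion along a segment -/

/-- The second derivative is neither continuous nor known to be integrable, so the integral form of
the remainder is replaced by two applications of the mean value inequality. -/
lemma abs_taylor_two_le {g g' g'' : ℝ → ℝ} {W : ℝ}
    (h1 : ∀ θ ∈ Set.Icc (0 : ℝ) 1, HasDerivAt g (g' θ) θ)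
    (h2 : ∀ θ ∈ Set.Icc (0 : ℝ) 1, HasDerivAt g' (g'' θ) θ)
    (hW : ∀ θ ∈ Set.Icc (0 : ℝ) 1, |g'' θ - g'' 0| ≤ W) :
    |g 1 - g 0 - g' 0 - g'' 0 / 2| ≤ W := by
  have hW0 : 0 ≤ W := (abs_nonneg _).trans (hW 0 (by simp))
  have hk : ∀ θ ∈ Set.Icc (0 : ℝ) 1, |g' θ - g' 0 - θ * g'' 0| ≤ W := by
    intro θ hθ
    have hd : ∀ s ∈ Set.Icc (0 : ℝ) θ, HasDerivWithinAt (fun s => g' s - s * g'' 0)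
        (g'' s - g'' 0) (Set.Icc 0 θ) s := fun s hs => by
      have := ((h2 s ⟨hs.1, hs.2.trans hθ.2⟩).fun_sub
        ((hasDerivAt_id s).mul_const (g'' 0))).hasDerivWithinAt (s := Set.Icc 0 θ)
      simpa using this
    have := norm_image_sub_le_of_norm_deriv_le_segment' hd
      (fun s hs => hW s ⟨hs.1, hs.2.le.trans hθ.2⟩) θ ⟨hθ.1, le_rfl⟩
    rw [Real.norm_eq_abs] at this
    calc _ = |g' θ - θ * g'' 0 - (g' 0 - 0 * g'' 0)| := by congr 1; ring
      _ ≤ _ := this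
      _ ≤ W := by nlinarith [hθ.1, hθ.2]
  have hd : ∀ s ∈ Set.Icc (0 : ℝ) 1, HasDerivWithinAt
      (fun s => g s - s * g' 0 - s ^ 2 / 2 * g'' 0)
      (g' s - g' 0 - s * g'' 0) (Set.Icc 0 1) s := fun s hs => by
    have e1 := (h1 s hs).sub ((hasDerivAt_id s).mul_const (g' 0))
    have e2 := e1.sub ((((hasDerivAt_id s).pow 2).div_const 2).mul_const (g'' 0))
    refine (e2.hasDerivWithinAt (s := Set.Icc 0 1)).congr_deriv ?_
    simp
  have := norm_image_sub_le_of_norm_deriv_le_segment_01' hd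
    (fun s hs => hk s ⟨hs.1, hs.2.le⟩)
  rw [Real.norm_eq_abs] at this
  calc _ = |g 1 - 1 * g' 0 - 1 ^ 2 / 2 * g'' 0 - (g 0 - 0 * g' 0 - 0 ^ 2 / 2 * g'' 0)| := by
        congr 1; ring
    _ ≤ W := this

lemma inner_eq_sum (v w : EuclideanSpace ℝ (Fin m)) : inner ℝ v w = ∑ i, v i * w i := by
  simp [PiLp.inner_apply, mul_comm]

lemma HasGradientAt.hasDerivAt_segment {φ : EuclideanSpace ℝ (Fin m) → ℝ}
    {v δ : EuclideanSpace ℝ (Fin m)} {θ : ℝ} (h : HasGradientAt φ v (θ • δ)) :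
    HasDerivAt (fun s : ℝ => φ (s • δ)) (∑ i, v i * δ i) θ := by
  have h1 : HasDerivAt (fun s : ℝ => s • δ) δ θ := by
    simpa using (hasDerivAt_id θ).smul_const δ
  have := h.hasFDerivAt.comp_hasDerivAt θ h1
  rwa [InnerProductSpace.toDual_apply_apply, inner_eq_sum] at this

/-- Vertical derivatives are taken at zero perturbation. Since perturbations at the same time add
up, a translation moves the base point to e. -/
lemma VertDifferentiableAt.hasGradientAt {F : Functional m ℝ} {t : ℝ≥0} {y : Traj m}
    {e : EuclideanSpace ℝ (Fin m)} (h : VertDifferentiableAt F t (bump y t e)) :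
    HasGradientAt (fun e' => F t (bump y t e')) (vertGrad F t (bump y t e)) e := by
  have h1 := DifferentiableAt.hasGradientAt h
  have h2 : HasFDerivAt (fun e' => e' - e) (ContinuousLinearMap.id ℝ _) e :=
    (hasFDerivAt_id e).sub_const e
  have h3 : HasFDerivAt (fun e' => F t (bump (bump y t e) t e'))
      (InnerProductSpace.toDual ℝ _ (vertGrad F t (bump y t e))) (e - e) := by
    rw [sub_self]; exact h1.hasFDerivAt
  have h4 := HasFDerivAt.comp (f := fun e' => e' - e) e h3 h2
  simp only [Function.comp_def, bump_bump, add_sub_cancel, ContinuousLinearMap.comp_id] at h4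
  exact h4

/-- Second-order expansion of a functional in the vertical direction. -/
theorem abs_vertical_taylor_le {F : Functional m ℝ} {t : ℝ≥0} {y : Traj m}
    {δ : EuclideanSpace ℝ (Fin m)}
    (h1 : ∀ θ ∈ Set.Icc (0 : ℝ) 1, VertDifferentiableAt F t (bump y t (θ • δ)))
    (h2 : ∀ i, ∀ θ ∈ Set.Icc (0 : ℝ) 1,
      VertDifferentiableAt (fun s z => vertGrad F s z i) t (bump y t (θ • δ)))
    {w : Fin m → Fin m → ℝ}
    (hw : ∀ i j, ∀ θ ∈ Set.Icc (0 : ℝ) 1,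
      |vertHess F t (bump y t (θ • δ)) i j - vertHess F t y i j| ≤ w i j) :
    |F t (bump y t δ) - F t y - inner ℝ (vertGrad F t y) δ
      - (∑ i, ∑ j, vertHess F t y i j * (δ i * δ j)) / 2| ≤ ∑ i, ∑ j, w i j * (|δ i| * |δ j|) := by
  have key := abs_taylor_two_le (g := fun θ => F t (bump y t (θ • δ)))
    (g' := fun θ => ∑ i, vertGrad F t (bump y t (θ • δ)) i * δ i)
    (g'' := fun θ => ∑ i, ∑ j, vertHess F t (bump y t (θ • δ)) i j * (δ i * δ j))
    (W := ∑ i, ∑ j, w i j * (|δ i| * |δ j|)) ?_ ?_ ?_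
  · simpa [bump_zero, inner_eq_sum] using key
  · intro θ hθ
    exact HasGradientAt.hasDerivAt_segment (h1 θ hθ).hasGradientAt
  · intro θ hθ
    have := HasDerivAt.fun_sum (u := Finset.univ) fun i _ =>
      (HasGradientAt.hasDerivAt_segment (h2 i θ hθ).hasGradientAt).mul_const (δ i)
    refine this.congr_deriv (Finset.sum_congr rfl fun i _ => ?_)
    rw [Finset.sum_mul]
    refine Finset.sum_congr rfl fun j _ => ?_
    simp only [vertHess, Matrix.of_apply]
    ring
  · intro θ hθ
    simp only [zero_smul, bump_zero, ← Finset.sum_sub_distrib, ← sub_mul]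
    refine (Finset.abs_sum_le_sum_abs _ _).trans (Finset.sum_le_sum fun i _ => ?_)
    refine (Finset.abs_sum_le_sum_abs _ _).trans (Finset.sum_le_sum fun j _ => ?_)
    rw [abs_mul, abs_mul]
    exact mul_le_mul_of_nonneg_right (hw i j θ hθ) (by positivity)

/-! ### Horizontal increments -/

lemma eventually_cumul_left (P : Finset ℝ≥0) (a : ℝ≥0 → ℝ) (t : ℝ≥0) :
    ∀ᶠ s in 𝓝[<] t, cumul P a s = cumulLt P a t := by
  have h : ∀ᶠ s in 𝓝[<] t, ∀ u ∈ P, u ≤ s ↔ u < t := by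
    refine (Finset.eventually_all P).2 fun u _ => ?_
    rcases lt_or_ge u t with h | h
    · filter_upwards [Ioo_mem_nhdsLT h] with s hs
      exact ⟨fun _ => h, fun _ => hs.1.le⟩
    · filter_upwards [self_mem_nhdsWithin] with s hs
      exact ⟨fun h' => absurd (h'.trans_lt hs) (not_lt.2 h), fun h' => absurd h' (not_lt.2 h)⟩
  filter_upwards [h] with s hs
  unfold cumul cumulLt
  rw [Finset.filter_congr hs]

lemma eventually_cumul_right (P : Finset ℝ≥0) (a : ℝ≥0 → ℝ) (t : ℝ≥0) :
    ∀ᶠ s in 𝓝[≥] t, cumul P a s = cumul P a t := by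
  have h : ∀ᶠ s in 𝓝[≥] t, ∀ u ∈ P, u ≤ s ↔ u ≤ t := by
    refine (Finset.eventually_all P).2 fun u _ => ?_
    rcases lt_or_ge t u with h | h
    · filter_upwards [Ico_mem_nhdsGE h] with s hs
      exact ⟨fun h' => absurd hs.2 (not_lt.2 h'), fun h' => absurd h (not_lt.2 h')⟩
    · filter_upwards [self_mem_nhdsWithin] with s hs
      exact ⟨fun _ => h, fun h' => h'.trans hs⟩
  filter_upwards [h] with s hs
  unfold cumul
  rw [Finset.filter_congr hs]

lemma eventually_stopAt_right {z : Traj m} {t : ℝ≥0} (hz : ∀ᶠ s in 𝓝[≥] t, z s = z t) :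
    ∀ᶠ s in 𝓝[≥] t, stopAt z s = stopAt z t := by
  obtain ⟨u, hu, h⟩ := (mem_nhdsGE_iff_exists_Ico_subset (a := t)).1 hz
  filter_upwards [Ico_mem_nhdsGE hu] with s hs
  ext1 r
  unfold stopAt
  rcases le_total r t with hr | hr
  · rw [min_eq_left hr, min_eq_left (hr.trans hs.1)]
  · rw [min_eq_right hr]
    exact h ⟨le_min hr hs.1, (min_le_right _ _).trans_lt hs.2⟩

lemma HasHorizDeriv.horizDeriv_eq {F : Functional m ℝ} {t : ℝ≥0} {y : Traj m} {l : ℝ}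
    (h : HasHorizDeriv F t y l) : horizDeriv F t y = l := Tendsto.limUnder_eq h

lemma tendsto_toNNReal_sub {u : ℝ} (hu : 0 ≤ u) :
    Tendsto (fun v : ℝ => v.toNNReal - u.toNNReal) (𝓝[>] u) (𝓝[>] 0) := by
  refine tendsto_nhdsWithin_iff.2 ⟨?_, ?_⟩
  · have h : Continuous fun v : ℝ => v.toNNReal - u.toNNReal :=
      continuous_real_toNNReal.sub continuous_const
    have := h.tendsto u
    rw [tsub_self] at this
    exact this.mono_left nhdsWithin_le_nhds
  · filter_upwards [self_mem_nhdsWithin] with v hv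
    exact tsub_pos_of_lt ((Real.toNNReal_lt_toNNReal_iff_of_nonneg hu).2 hv)

/-- Along a path that is constant to the right of every time and jumps in `P` only, a functional
is the integral of its horizontal derivative plus the sum of its jumps. -/
theorem eq_integral_horizDeriv_add_sum {π : PartitionSeq} {Ω : Set (Traj m)} {F : Functional m ℝ}
    (hl : LeftCts π Ω F) (hr : RightCts π Ω F)
    (hD : ∀ x ∈ Ω, ∀ t, ∃ l, HasHorizDeriv F t (stopAt x t) l)
    {z : Traj m} (hz : z ∈ Ω) (hc : ∀ t, ∀ᶠ s in 𝓝[≥] t, z s = z t)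
    {P : Finset ℝ≥0} (hP : ∀ t, t ∉ P → jump z t = 0) {T : ℝ≥0}
    (hint : IntervalIntegrable (fun u : ℝ => horizDeriv F u.toNNReal (stopAt z u.toNNReal))
      volume 0 T) :
    F T (stopAt z T) = F 0 (stopAt z 0)
      + (∫ u in (0 : ℝ)..T, horizDeriv F u.toNNReal (stopAt z u.toNNReal))
      + cumul P (fun t => F t (stopAt z t) - F t (stopLeft z t)) T := by
  set J : ℝ≥0 → ℝ := fun t => F t (stopAt z t) - F t (stopLeft z t) with hJ
  have hJ0 : ∀ t, t ∉ P → J t = 0 := fun t ht => by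
    simp only [hJ, stopLeft_eq_stopAt (hP t ht), sub_self]
  -- Removing the accumulated jumps leaves a continuous function of time, so a right derivative
  -- suffices for the fundamental theorem of calculus.
  set Ψ : ℝ≥0 → ℝ := fun s => F s (stopAt z s) - cumul P J s with hΨ
  have hcont : Continuous Ψ := by
    refine continuous_iff_continuousAt.2 fun t => ?_
    rw [continuousAt_iff_continuous_left_right, ← continuousWithinAt_Iio_iff_Iic]
    constructor
    · have h1 : Tendsto Ψ (𝓝[<] t) (𝓝 (F t (stopLeft z t) - cumulLt P J t)) :=
        (hl.b z hz t).sub (tendsto_const_nhds.congr'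
          ((eventually_cumul_left P J t).mono fun s hs => hs.symm))
      have h2 : Ψ t = F t (stopLeft z t) - cumulLt P J t := by
        simp only [hΨ, cumul_eq_cumulLt_add]
        split_ifs with h
        · simp only [hJ]; ring
        · have := hJ0 t h
          simp only [hJ] at this
          linarith
      rw [ContinuousWithinAt, h2]
      exact h1
    · exact (hr.a z hz t).sub (tendsto_const_nhds.congr'
          ((eventually_cumul_right P J t).mono fun s hs => hs.symm))
  have hderiv : ∀ u ∈ Set.Ioo (min (0 : ℝ) T) (max (0 : ℝ) T),
      HasDerivWithinAt (fun v : ℝ => Ψ v.toNNReal)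
        (horizDeriv F u.toNNReal (stopAt z u.toNNReal)) (Set.Ioi u) u := by
    intro u hu
    rw [min_eq_left T.coe_nonneg] at hu
    have hu0 : 0 ≤ u := hu.1.le
    obtain ⟨l, hlim⟩ := hD z hz u.toNNReal
    rw [hlim.horizDeriv_eq, hasDerivWithinAt_iff_tendsto_slope' (by simp)]
    refine (Tendsto.comp hlim (tendsto_toNNReal_sub hu0)).congr' ?_
    have hto : Tendsto Real.toNNReal (𝓝[>] u) (𝓝[≥] u.toNNReal) :=
      tendsto_nhdsWithin_iff.2 ⟨(continuous_real_toNNReal.tendsto u).mono_left nhdsWithin_le_nhds,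
        by filter_upwards [self_mem_nhdsWithin] with v hv
           exact Real.toNNReal_le_toNNReal (le_of_lt hv)⟩
    -- For v slightly above u the path stopped at v is the path stopped at u and no jump is added,
    -- so the slope is the horizontal difference quotient.
    filter_upwards [self_mem_nhdsWithin, hto.eventually (eventually_stopAt_right (hc _)),
      hto.eventually (eventually_cumul_right P J _)] with v hv h1 h2
    have hv' : u ≤ v := le_of_lt hv
    have hle : u.toNNReal ≤ v.toNNReal := Real.toNNReal_le_toNNReal hv'
    simp only [Function.comp, slope_def_field, hΨ, h1, h2]
    rw [add_tsub_cancel_of_le hle, NNReal.coe_sub hle, Real.coe_toNNReal _ hu0,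
      Real.coe_toNNReal _ (hu0.trans hv')]
    congr 1
    ring
  have := intervalIntegral.integral_eq_sub_of_hasDeriv_right
    (hcont.comp continuous_real_toNNReal).continuousOn hderiv hint
  rw [this]
  have h0 : cumul P J 0 = 0 := by
    rw [cumul_eq_cumulLt_add, cumulLt_zero]
    simp [hJ, stopLeft_zero]
  simp only [Function.comp, Real.toNNReal_coe, Real.toNNReal_zero, hΨ, h0]
  ring

/-! ### The horizontal part of the change of variable formula -/

lemma stopLeft_stopAt_of_le (x : Traj m) {t T : ℝ≥0} (h : t ≤ T) :
    stopLeft (stopAt x T) t = stopLeft x t := by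
  rw [← stopLeft_stopAt, stopAt_stopAt_of_le _ h, stopLeft_stopAt]

lemma jump_stopAt_of_le (x : Traj m) {t T : ℝ≥0} (h : t ≤ T) :
    jump (stopAt x T) t = jump x t := by
  rw [← jump_stopAt, stopAt_stopAt_of_le _ h, jump_stopAt]

lemma minus_stopLeft {V : Type} (F : Functional m V) (t : ℝ≥0) (x : Traj m) :
    minus F t (stopLeft x t) = F t (stopLeft x t) := by
  rw [minus, stopLeft_stopLeft]

lemma minus_stopAt {V : Type} (F : Functional m V) (t : ℝ≥0) (x : Traj m) :
    minus F t (stopAt x t) = F t (stopLeft x t) := by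
  rw [minus, stopLeft_stopAt]

lemma stopAt_approx_eventually_right {P : Finset ℝ≥0} (h0 : 0 ∈ P) (x : Traj m) {T : ℝ≥0}
    (hT : T < P.sup id) (t : ℝ≥0) :
    ∀ᶠ s in 𝓝[≥] t, stopAt (approx P x) T s = stopAt (approx P x) T t := by
  rcases lt_or_ge t T with h | h
  · filter_upwards [approx_eventually_right h0 x (h.trans hT), Ico_mem_nhdsGE h] with s hs hs'
    simp only [stopAt, min_eq_left hs'.2.le, min_eq_left h.le, hs.1]
  · filter_upwards [self_mem_nhdsWithin] with s hs
    simp only [stopAt, min_eq_right h, min_eq_right (h.trans hs)]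

lemma jump_stopAt_approx_eq_zero {P : Finset ℝ≥0} (h0 : 0 ∈ P) (x : Traj m) {T : ℝ≥0}
    (hT : T < P.sup id) {t : ℝ≥0} (ht : t ∉ P) : jump (stopAt (approx P x) T) t = 0 := by
  rcases le_or_gt t T with h | h
  · rw [jump_stopAt_of_le _ h, jump_approx_eq_zero h0 x ht (h.trans_lt hT)]
  · have := nhdsLT_neBot (pos_of_gt h)
    rw [jump, leftLim_eq_of_tendsto (y := stopAt (approx P x) T t), sub_self]
    refine tendsto_const_nhds.congr' ?_
    filter_upwards [Ioo_mem_nhdsLT h] with s hs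
    simp only [stopAt, min_eq_right h.le, min_eq_right hs.1.le]

lemma intervalIntegrable_of_bdd {f : ℝ≥0 → ℝ} (hf : Measurable f) {K : ℝ} {T : ℝ≥0}
    (h : ∀ s ≤ T, |f s| ≤ K) : IntervalIntegrable (fun u : ℝ => f u.toNNReal) volume 0 T := by
  rw [intervalIntegrable_iff_integrableOn_Ioc_of_le T.coe_nonneg]
  refine Measure.integrableOn_of_bounded (M := K) (by simp)
    (hf.comp measurable_real_toNNReal).aestronglyMeasurable ?_
  refine (ae_restrict_iff' measurableSet_Ioc).2 (.of_forall fun u hu => h _ ?_)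
  exact Real.toNNReal_le_iff_le_coe.2 hu.2

section Horizontal
variable {π : PartitionSeq} {Ω : Set (Traj m)} {F : Functional m ℝ} {x : Traj m}

lemma RightCts.measurable (hF : RightCts π Ω F) (hx : x ∈ Ω) :
    Measurable fun s => F s (stopAt x s) :=
  measurable_of_rightCts fun t => hF.a x hx t

lemma LeftCts.measurable (hF : LeftCts π Ω (minus F)) (hx : x ∈ Ω) :
    Measurable fun s => F s (stopLeft x s) := by
  have := measurable_of_leftCts fun t => hF.a x hx t
  simpa only [minus_stopLeft] using this

lemma RightCts.tendsto_approx (hF : RightCts π Ω F) (hx : x ∈ Ω) (t : ℝ≥0) :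
    Tendsto (fun n => F t (stopAt (approx (π.pts n) x) t)) atTop (𝓝 (F t (stopAt x t))) :=
  hF.c x hx t (fun _ => t) tendsto_const_nhds fun _ => prev_le _ _

/-- The time integrals of a right-continuous locally bounded functional along the approximations
converge. -/
theorem tendsto_integral_approx (hΩ : IsGeneric π Ω) (hF : RightCts π Ω F)
    (hb : LocallyBdd π Ω F) (hx : x ∈ Ω) (T : ℝ≥0) :
    IntervalIntegrable (fun u : ℝ => F u.toNNReal (stopAt x u.toNNReal)) volume 0 T ∧
    (∀ᶠ n in atTop, IntervalIntegrable (fun u : ℝ => F u.toNNReal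
      (stopAt (stopAt (approx (π.pts n) x) T) u.toNNReal)) volume 0 T) ∧
    Tendsto (fun n => ∫ u in (0 : ℝ)..T, F u.toNNReal
      (stopAt (stopAt (approx (π.pts n) x) T) u.toNNReal)) atTop
      (𝓝 (∫ u in (0 : ℝ)..T, F u.toNNReal (stopAt x u.toNNReal))) := by
  obtain ⟨n₀, K, hK⟩ := hb x hx T
  have hΩn := hΩ.eventually_approx hx T
  -- Local boundedness speaks of the approximations only; the bound along x follows in the limit.
  have hle : ∀ s ≤ T, |F s (stopAt x s)| ≤ K := fun s hs =>
    le_of_tendsto (hF.tendsto_approx hx s).abs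
      (eventually_atTop.2 ⟨n₀, fun n hn => hK n hn s hs⟩)
  have hK' : ∀ n ≥ n₀, ∀ s ≤ T, |F s (stopAt (stopAt (approx (π.pts n) x) T) s)| ≤ K := by
    intro n hn s hs
    rw [stopAt_stopAt_of_le _ hs]
    exact hK n hn s hs
  refine ⟨intervalIntegrable_of_bdd (hF.measurable hx) hle, ?_, ?_⟩
  · filter_upwards [hΩn, eventually_ge_atTop n₀] with n h1 h2
    exact intervalIntegrable_of_bdd (hF.measurable (h1 T le_rfl)) (hK' n h2)
  · refine intervalIntegral.tendsto_integral_filter_of_dominated_convergence (fun _ => K) ?_ ?_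
      intervalIntegrable_const ?_
    · filter_upwards [hΩn] with n h1
      exact ((hF.measurable (h1 T le_rfl)).comp measurable_real_toNNReal).aestronglyMeasurable
    · filter_upwards [eventually_ge_atTop n₀] with n h2
      refine .of_forall fun u hu => hK' n h2 _ ?_
      rw [Set.uIoc_of_le T.coe_nonneg] at hu
      exact Real.toNNReal_le_iff_le_coe.2 hu.2
    · refine .of_forall fun u hu => ?_
      rw [Set.uIoc_of_le T.coe_nonneg] at hu
      have hu' : u.toNNReal ≤ T := Real.toNNReal_le_iff_le_coe.2 hu.2
      simp only [stopAt_stopAt_of_le _ hu']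
      exact hF.tendsto_approx hx _

/-- The increments of a functional along the approximations. -/
theorem eventually_increment_approx (hΩ : IsGeneric π Ω) (hF : IsC12 π Ω F) (hx : x ∈ Ω)
    (T : ℝ≥0) :
    ∀ᶠ n in atTop, F T (stopAt (approx (π.pts n) x) T) = F 0 (stopAt (approx (π.pts n) x) 0)
      + (∫ u in (0 : ℝ)..T, horizDeriv F u.toNNReal
          (stopAt (stopAt (approx (π.pts n) x) T) u.toNNReal))
      + cumul (π.pts n) (fun t => F t (stopAt (approx (π.pts n) x) t) -
          F t (stopLeft (approx (π.pts n) x) t)) T := by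
  filter_upwards [hΩ.eventually_approx hx T, π.eventually_lt_sup T,
    (tendsto_integral_approx hΩ hF.horiz_rightCts hF.horiz_locallyBdd hx T).2.1] with n h1 h2 h3
  -- Genericity provides only stopped approximations in Ω. Stopping at T changes nothing up to T.
  have := eq_integral_horizDeriv_add_sum (hF.continuous.leftCts hΩ) (hF.continuous.rightCts hΩ)
    hF.horizDiff (h1 T le_rfl) (stopAt_approx_eventually_right (π.zero_mem n) x h2)
    (fun t ht => jump_stopAt_approx_eq_zero (π.zero_mem n) x h2 ht) h3
  rw [stopAt_stopAt_of_le _ le_rfl, stopAt_stopAt_of_le _ zero_le] at this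
  rw [this]
  congr 1
  refine Finset.sum_congr rfl fun t ht => ?_
  have htT := (Finset.mem_filter.1 ht).2
  simp only [stopAt_stopAt_of_le _ htT, stopLeft_stopAt_of_le _ htT]

end Horizontal

/-! ### The second-order terms -/

section Hessian
variable {π : PartitionSeq} {Ω : Set (Traj m)} {F : Functional m ℝ} {x : Traj m}

lemma LeftCts.convergesLeft (hF : LeftCts π Ω (minus F)) (hx : x ∈ Ω) :
    ConvergesLeft π (fun n t => F t (stopLeft (approx (π.pts n) x) t))
      fun t => F t (stopLeft x t) := by
  intro t s hs hs'
  simpa only [minus_stopLeft] using hF.tendsto_approx hx hs hs'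

lemma LocallyBdd.eventually_minus (hF : LocallyBdd π Ω (minus F)) (hx : x ∈ Ω) (T : ℝ≥0) :
    ∃ K, ∀ᶠ n in atTop, ∀ t ≤ T, |F t (stopLeft (approx (π.pts n) x) t)| ≤ K := by
  obtain ⟨n₀, K, hK⟩ := hF x hx T
  refine ⟨K, eventually_atTop.2 ⟨n₀, fun n hn t ht => ?_⟩⟩
  simpa only [minus_stopAt] using hK n hn t ht

variable {q : ℝ≥0 → Matrix (Fin m) (Fin m) ℝ}

/-- The products of increments have no sign, so the two polarized nonnegative weights are treated
separately and subtracted. -/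
lemma tendsto_sum_hess (hF : LeftCts π Ω (minus F)) (hb : LocallyBdd π Ω (minus F)) (hx : x ∈ Ω)
    (hxc : IsCadlag x) (hq : HasQuadVar π x q) (i j : Fin m) (T : ℝ≥0) :
    Tendsto (fun n => ∑ t ∈ (π.pts n).filter (fun t => t ≤ T),
        F t (stopLeft (approx (π.pts n) x) t) *
          ((x (next (π.pts n) t) - x t) i * (x (next (π.pts n) t) - x t) j)) atTop
      (𝓝 (∫ t, F t (stopLeft x t) ∂stieltjes (polarLimit q 1 i j) T -
        ∫ t, F t (stopLeft x t) ∂stieltjes (polarLimit q (-1) i j) T)) := by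
  obtain ⟨K, hK⟩ := hb.eventually_minus hx T
  have hK' : ∀ᶠ n in atTop, ∀ t ∈ π.pts n, t ≤ T →
      |F t (stopLeft (approx (π.pts n) x) t)| ≤ K := hK.mono fun n hn t _ ht => hn t ht
  have h1 := ((hq.weightLimit_polar hxc 1 i j).tendsto_sum_of_convergesLeft
    (hF.convergesLeft hx) (hF.measurable hx) hK').2
  have h2 := ((hq.weightLimit_polar hxc (-1) i j).tendsto_sum_of_convergesLeft
    (hF.convergesLeft hx) (hF.measurable hx) hK').2
  refine (h1.sub h2).congr fun n => ?_
  rw [← Finset.sum_sub_distrib]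
  refine Finset.sum_congr rfl fun t _ => ?_
  rw [← mul_sub, weight, weight, polar_sub_polar]

lemma integrable_hess (hF : LeftCts π Ω (minus F)) (hb : LocallyBdd π Ω (minus F)) (hx : x ∈ Ω)
    (hxc : IsCadlag x) (hq : HasQuadVar π x q) (σ : ℝ) (i j : Fin m) (T : ℝ≥0) :
    Integrable (fun t => F t (stopLeft x t)) (stieltjes (polarLimit q σ i j) T) := by
  obtain ⟨K, hK⟩ := hb.eventually_minus hx T
  exact ((hq.weightLimit_polar hxc σ i j).tendsto_sum_of_convergesLeft
    (hF.convergesLeft hx) (hF.measurable hx) (hK.mono fun n hn t _ ht => hn t ht)).1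

lemma WeightLimit.restrict_Ioc {b : EuclideanSpace ℝ (Fin m) → ℝ} {G : ℝ≥0 → ℝ}
    (W : WeightLimit π x b G) (T : ℝ≥0) :
    (stieltjes G T).restrict (Set.Ioc 0 T) = stieltjes G T := by
  refine Measure.restrict_eq_self_of_ae_mem ?_
  refine (ae_map_iff measurable_quantile.aemeasurable measurableSet_Ioc).2 ?_
  refine (ae_restrict_iff' measurableSet_Ioc).2 (.of_forall fun u hu => ⟨?_, quantile_le u⟩)
  exact (lt_quantile_iff W.mono (fun t => (W.limit t).1) hu.2).2 (by rw [W.apply_zero]; exact hu.1)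

/-- The continuous part of the quadratic variation and its Stieltjes integrals. -/
theorem hasStieltjesIntegral_contQuadVar (hxc : IsCadlag x)
    (hq : HasQuadVar π x (quadVar π x)) {f : ℝ≥0 → ℝ} (i j : Fin m) {T : ℝ≥0}
    (hf : ∀ σ, Integrable f (stieltjes (polarLimit (quadVar π x) σ i j) T)) :
    HasStieltjesIntegral f (contQuadVar π x i j) T
      (∫ t in {t | jump x t ≠ 0}ᶜ, f t ∂stieltjes (polarLimit (quadVar π x) 1 i j) T -
        ∫ t in {t | jump x t ≠ 0}ᶜ, f t ∂stieltjes (polarLimit (quadVar π x) (-1) i j) T) := by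
  have hA := hq.countable_jumps hxc
  have W := fun σ => hq.weightLimit_polar hxc σ i j
  set A := {t | jump x t ≠ 0} with hAdef
  have hres : ∀ σ, ((stieltjes (polarLimit (quadVar π x) σ i j) T).restrict Aᶜ).restrict
      (Set.Ioc 0 T) = (stieltjes (polarLimit (quadVar π x) σ i j) T).restrict Aᶜ := by
    intro σ
    rw [Measure.restrict_restrict measurableSet_Ioc, Set.inter_comm,
      ← Measure.restrict_restrict hA.measurableSet.compl, (W σ).restrict_Ioc]
  have hcont : ∀ s ≤ T, contQuadVar π x i j s =
      ((stieltjes (polarLimit (quadVar π x) 1 i j) T).restrict Aᶜ).real (Set.Ioc 0 s) -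
      ((stieltjes (polarLimit (quadVar π x) (-1) i j) T).restrict Aᶜ).real (Set.Ioc 0 s) := by
    intro s hs
    have h := ((W 1).hasSum_jumps hA hs).sub ((W (-1)).hasSum_jumps hA hs)
    simp only [polar_sub_polar] at h
    rw [contQuadVar, h.tsum_eq, hq.entry_eq hxc]
    ring
  refine ⟨(stieltjes (polarLimit (quadVar π x) 1 i j) T).restrict Aᶜ,
    (stieltjes (polarLimit (quadVar π x) (-1) i j) T).restrict Aᶜ,
    inferInstance, inferInstance, fun s hs => ?_, ?_, ?_, ?_⟩
  · rw [hcont s hs, hcont 0 zero_le]; simp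
  · rw [IntegrableOn, hres]; exact (hf 1).integrableOn
  · rw [IntegrableOn, hres]; exact (hf (-1)).integrableOn
  · rw [hres, hres]

lemma summable_jumps (hxc : IsCadlag x) (hq : HasQuadVar π x q) (i j : Fin m) (T : ℝ≥0) :
    Summable fun s : Set.Iic T => jump x s i * jump x s j := by
  have hA := hq.countable_jumps hxc
  have h := ((hq.weightLimit_polar hxc 1 i j).hasSum_jumps hA (le_refl T)).sub
    ((hq.weightLimit_polar hxc (-1) i j).hasSum_jumps hA (le_refl T))
  simp only [polar_sub_polar] at h
  exact h.summable

end Hessian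

/-! ### The vertical remainder -/

/-- The increment of `x` over the partition interval starting at `t`. -/
noncomputable def incr (P : Finset ℝ≥0) (x : Traj m) (t : ℝ≥0) : EuclideanSpace ℝ (Fin m) :=
  x (next P t) - x t

/-- The second-order form `∑ ∂ᵢⱼF(t, x_{t-}) δᵢ δⱼ`. -/
noncomputable def hessForm (F : Functional m ℝ) (y : Traj m) (t : ℝ≥0)
    (δ : EuclideanSpace ℝ (Fin m)) : ℝ :=
  ∑ i, ∑ j, vertHess F t (stopLeft y t) i j * (δ i * δ j)

/-- The second-order remainder of a vertical increment `δ`, relative to `|δ|²`. -/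
noncomputable def remainderRatio (F : Functional m ℝ) (y : Traj m) (t : ℝ≥0)
    (δ : EuclideanSpace ℝ (Fin m)) : ℝ :=
  (F t (stopAt y t) - F t (stopLeft y t) - inner ℝ (vertGrad F t (stopLeft y t)) δ
    - hessForm F y t δ / 2) / ‖δ‖ ^ 2

section Remainder
variable {π : PartitionSeq} {Ω : Set (Traj m)} {F : Functional m ℝ} {x : Traj m}

/-- The chosen neighbourhood is convex and contains 0 and the jump, hence the segment between them.
The modulus is applied to a point of this segment and 0. -/
lemma HasVertModulus.exists_modulus {H : Functional m ℝ} (hH : HasVertModulus π Ω H)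
    (hΩ : IsGeneric π Ω) (hx : x ∈ Ω) (T : ℝ≥0) {r : ℝ} (hr : 0 < r) :
    ∃ ω : ℝ≥0 → ℝ≥0, Monotone ω ∧ Tendsto ω (𝓝[>] 0) (𝓝 0) ∧ ∀ᶠ n in atTop, ∀ t ≤ T,
      ‖jump (approx (π.pts n) x) t‖ ≤ r → ∀ θ ∈ Set.Icc (0 : ℝ) 1,
        |H t (bump (stopLeft (approx (π.pts n) x) t) t (θ • jump (approx (π.pts n) x) t)) -
          H t (stopLeft (approx (π.pts n) x) t)| ≤ ω ‖jump (approx (π.pts n) x) t‖₊ := by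
  obtain ⟨U, hU, h⟩ := hH
  obtain ⟨ω, hmono, hlim, hev⟩ := h x hx T r hr
  refine ⟨ω, hmono, hlim, ?_⟩
  filter_upwards [hev, hΩ.eventually_approx hx T] with n h1 h2 t ht hj θ hθ
  obtain ⟨hconv, hnhds, hjU, -⟩ := hU t _ (h2 t ht)
  have h0 := mem_of_mem_nhds hnhds
  have hmem : θ • jump (approx (π.pts n) x) t ∈ U t (approx (π.pts n) x) := by
    have := hconv h0 hjU (sub_nonneg.2 hθ.2) hθ.1 (by ring)
    rwa [smul_zero, zero_add] at this
  have hnorm : ‖θ • jump (approx (π.pts n) x) t‖ ≤ ‖jump (approx (π.pts n) x) t‖ := by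
    rw [norm_smul, Real.norm_of_nonneg hθ.1]
    exact mul_le_of_le_one_left (norm_nonneg _) hθ.2
  have := h1 t ht _ ⟨hmem, mem_closedBall_zero_iff.2 (hnorm.trans hj)⟩ 0
    ⟨h0, mem_closedBall_zero_iff.2 (by simpa using hr.le)⟩
  rw [bump_zero, sub_zero] at this
  exact this.trans (NNReal.coe_le_coe.2 (hmono hnorm))

/-- Differentiability is assumed at stopped paths only; the perturbed path is in Ω and already
stopped at t. -/
lemma vertDifferentiableAt_segment {H : Functional m ℝ} (hΩ : IsGeneric π Ω)
    (hH : ∀ x ∈ Ω, ∀ t, VertDifferentiableAt H t (stopAt x t)) {y : Traj m} {t : ℝ≥0}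
    (hy : stopAt y t ∈ Ω) {θ : ℝ} (hθ : θ ∈ Set.Icc (0 : ℝ) 1) :
    VertDifferentiableAt H t (bump (stopLeft y t) t (θ • jump y t)) := by
  have := hH _ (hΩ.segment_mem hy hθ.1 hθ.2) t
  rw [bump_stopLeft] at this ⊢
  rwa [stopAt_bump_stopAt] at this

/-- The relative remainders of the vertical increments of the approximations have a modulus. -/
theorem exists_remainderRatio_le (hΩ : IsGeneric π Ω) (hF : IsC12 π Ω F) (hx : x ∈ Ω) (T : ℝ≥0)
    {r : ℝ} (hr : 0 < r) :
    ∃ ω : ℝ≥0 → ℝ≥0, Monotone ω ∧ Tendsto ω (𝓝[>] 0) (𝓝 0) ∧ ∀ᶠ n in atTop, ∀ t ≤ T,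
      ‖jump (approx (π.pts n) x) t‖ ≤ r →
        |remainderRatio F (approx (π.pts n) x) t (jump (approx (π.pts n) x) t)| ≤
          ω ‖jump (approx (π.pts n) x) t‖₊ := by
  choose ω hmono hlim hev using fun i j => (hF.hess_modulus i j).exists_modulus hΩ hx T hr
  refine ⟨fun d => ∑ i, ∑ j, ω i j d, fun d e h => Finset.sum_le_sum fun i _ =>
    Finset.sum_le_sum fun j _ => hmono i j h, ?_, ?_⟩
  · have := tendsto_finsetSum Finset.univ fun i _ => tendsto_finsetSum Finset.univ
      fun j _ => hlim i j
    simpa using this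
  · filter_upwards [eventually_all.2 fun i => eventually_all.2 (hev i), hΩ.eventually_approx hx T]
      with n h1 h2 t ht hj
    set y := approx (π.pts n) x
    set δ := jump y t
    have key := abs_vertical_taylor_le (F := F) (t := t) (y := stopLeft y t) (δ := δ)
      (fun θ hθ => vertDifferentiableAt_segment hΩ hF.vertDiff (h2 t ht) hθ)
      (fun i θ hθ => vertDifferentiableAt_segment hΩ (hF.vertDiff₂ i) (h2 t ht) hθ)
      (w := fun i j => ω i j ‖δ‖₊) (fun i j θ hθ => h1 i j t ht hj θ hθ)
    have hy : bump (stopLeft y t) t δ = stopAt y t := by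
      rw [bump_stopLeft, sub_self, bump_zero]
    rw [hy] at key
    rw [remainderRatio, abs_div, abs_of_nonneg (sq_nonneg ‖δ‖)]
    refine div_le_of_le_mul₀ (sq_nonneg _) (NNReal.coe_nonneg _) (key.trans ?_)
    push_cast
    rw [Finset.sum_mul]
    refine Finset.sum_le_sum fun i _ => ?_
    rw [Finset.sum_mul]
    refine Finset.sum_le_sum fun j _ => ?_
    refine mul_le_mul_of_nonneg_left ?_ (NNReal.coe_nonneg _)
    rw [sq]
    exact mul_le_mul (PiLp.norm_apply_le δ i) (PiLp.norm_apply_le δ j) (abs_nonneg _)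
      (norm_nonneg _)

/-- The limit of the relative remainders at the jump times of the path. -/
lemma tendsto_remainderRatio_prev (hΩ : IsGeneric π Ω) (hF : IsC12 π Ω F) (hx : x ∈ Ω)
    {t : ℝ≥0} (ht : 0 < t) (hj : jump x t ≠ 0) :
    Tendsto (fun n => remainderRatio F (approx (π.pts n) x) (prev (π.pts n) t)
      (incr (π.pts n) x (prev (π.pts n) t))) atTop (𝓝 (remainderRatio F x t (jump x t))) := by
  have hp := π.tendsto_prev t
  have hδ : Tendsto (fun n => incr (π.pts n) x (prev (π.pts n) t)) atTop (𝓝 (jump x t)) :=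
    tendsto_increment_prev π (hΩ.cadlag x hx) ht
  have hδi : ∀ i, Tendsto (fun n => incr (π.pts n) x (prev (π.pts n) t) i) atTop
      (𝓝 (jump x t i)) := fun i =>
    ((EuclideanSpace.proj (𝕜 := ℝ) i).continuous.tendsto _).comp hδ
  have hle : ∀ᶠ n in atTop, prev (π.pts n) t ≤ prev (π.pts n) t := .of_forall fun _ => le_rfl
  refine Tendsto.div (.sub (.sub (.sub ?_ ?_) ?_) (.div_const ?_ _)) (hδ.norm.pow 2)
    (by simpa using hj)
  -- The partition point preceding t is admissible for both one-sided continuities: there the value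
  -- of F tends to F(t, x_t), and its value just before the jump to F(t, x_{t-}).
  · exact (hF.continuous.rightCts hΩ).c x hx t _ hp fun _ => le_rfl
  · exact (hF.continuous.leftCts hΩ).c x hx t _ hp fun _ => le_rfl
  · simp only [inner_eq_sum]
    exact tendsto_finsetSum _ fun i _ =>
      ((hF.grad_leftCts i).convergesLeft hx t _ hp hle).mul (hδi i)
  · exact tendsto_finsetSum _ fun i _ => tendsto_finsetSum _ fun j _ =>
      ((hF.hess_leftCts i j).convergesLeft hx t _ hp hle).mul ((hδi i).mul (hδi j))

lemma remainderRatio_zero (F : Functional m ℝ) (y : Traj m) (t : ℝ≥0) :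
    remainderRatio F y t 0 = 0 := by
  simp [remainderRatio]

/-- This identity turns the atoms of the limiting remainder integral into jump terms; at a vanishing
jump both sides are 0. -/
lemma remainderRatio_mul {y : Traj m} {t : ℝ≥0} :
    remainderRatio F y t (jump y t) * ‖jump y t‖ ^ 2 =
      jumpTerm F y t - hessForm F y t (jump y t) / 2 := by
  by_cases h : jump y t = 0
  · simp [remainderRatio, jumpTerm, hessForm, h, stopLeft_eq_stopAt h]
  · have : ‖jump y t‖ ^ 2 ≠ 0 := by simpa using h
    rw [remainderRatio, div_mul_cancel₀ _ this, jumpTerm]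

variable {q : ℝ≥0 → Matrix (Fin m) (Fin m) ℝ}

/-- The sum of the vertical remainders converges to an integral carried by the jump times. -/
theorem tendsto_sum_remainder (hΩ : IsGeneric π Ω) (hF : IsC12 π Ω F) (hx : x ∈ Ω)
    (hq : HasQuadVar π x q) (T : ℝ≥0) :
    Integrable (fun t => remainderRatio F x t (jump x t)) (stieltjes (traceLimit q) T) ∧
    Tendsto (fun n => ∑ t ∈ (π.pts n).filter (fun t => t ≤ T),
        remainderRatio F (approx (π.pts n) x) t (jump (approx (π.pts n) x) t) *
          ‖jump (approx (π.pts n) x) t‖ ^ 2) atTop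
      (𝓝 (∫ t, remainderRatio F x t (jump x t) ∂stieltjes (traceLimit q) T)) := by
  have hxc := hΩ.cadlag x hx
  have W := hq.weightLimit_trace hxc
  set r : ℝ := traceLimit q T + 1 with hrdef
  have hr : 0 < r := by
    have : traceLimit q 0 ≤ traceLimit q T := W.mono zero_le
    rw [W.apply_zero] at this
    positivity
  obtain ⟨ω, hmono, hlim, hev⟩ := exists_remainderRatio_le hΩ hF hx T (r := r + 1) (by positivity)
  have hjump : ∀ᶠ n in atTop, ∀ t ∈ π.pts n, 0 < t → t ≤ T →
      jump (approx (π.pts n) x) t = incr (π.pts n) x t := by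
    filter_upwards [π.eventually_lt_sup T] with n hn t ht h0 htT
    exact jump_approx (π.zero_mem n) x ht h0 (htT.trans_lt hn)
  have hbound : ∀ᶠ n in atTop, ∀ t ∈ π.pts n, t ≤ T → ‖jump (approx (π.pts n) x) t‖ ≤ r + 1 := by
    filter_upwards [hjump, (W.tendsto_cumul T).eventually_lt_const (show traceLimit q T < r by
      simp [hrdef])] with n h1 h2 t ht htT
    rcases eq_or_ne t 0 with rfl | h0
    · rw [jump_zero, norm_zero]; positivity
    · rw [h1 t ht (pos_iff_ne_zero.2 h0) htT]
      have h3 : weight (π.pts n) x (fun d => ‖d‖ ^ 2) t ≤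
          cumul (π.pts n) (weight (π.pts n) x fun d => ‖d‖ ^ 2) T :=
        Finset.single_le_sum (fun u _ => W.weight_nonneg n u)
          (Finset.mem_filter.2 ⟨ht, htT⟩)
      have h4 : ‖incr (π.pts n) x t‖ ^ 2 ≤ r := h3.trans h2.le
      -- From ‖δ‖² ≤ r follows ‖δ‖ ≤ (‖δ‖² + 1)/2 ≤ r + 1.
      nlinarith [sq_nonneg (‖incr (π.pts n) x t‖ - 1)]
  -- The modulus is small near 0, but its value at 0 is not controlled. Zero increments are excluded
  -- here and treated through `remainderRatio_zero`.
  have hω : ∀ ε > 0, ∀ᶠ d : EuclideanSpace ℝ (Fin m) in 𝓝 0, d ≠ 0 → (ω ‖d‖₊ : ℝ) < ε := by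
    intro ε hε
    have h1 : ∀ᶠ d in 𝓝[>] (0 : ℝ≥0), (ω d : ℝ) < ε := by
      have := ((NNReal.continuous_coe.tendsto 0).comp hlim)
      exact this.eventually_lt_const (by simpa using hε)
    have h2 := eventually_nhdsWithin_iff.1 h1
    have h3 : Tendsto (fun d : EuclideanSpace ℝ (Fin m) => ‖d‖₊) (𝓝 0) (𝓝 0) := by
      simpa using (continuous_nnnorm (E := EuclideanSpace ℝ (Fin m))).tendsto 0
    filter_upwards [h3.eventually h2] with d hd hd0
    exact hd (by simpa [pos_iff_ne_zero] using hd0)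
  -- The ratio is formed with the jump of the approximation, not with the increment of x. They
  -- differ at time 0, where the jump is 0 and the term drops out although its weight may not
  -- vanish.
  have hmain := W.tendsto_sum_jumps (T := T) (fun d hd => by simpa using hd)
    (f := fun n t => remainderRatio F (approx (π.pts n) x) t (jump (approx (π.pts n) x) t))
    (ψ := fun t => remainderRatio F x t (jump x t)) (K := ω (r + 1).toNNReal) ?_ ?_ ?_ ?_
  · refine ⟨hmain.1, hmain.2.congr' ?_⟩
    filter_upwards [hjump] with n hn
    refine Finset.sum_congr rfl fun t ht => ?_
    rw [Finset.mem_filter] at ht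
    rcases eq_or_ne t 0 with rfl | h0
    · simp [jump_zero, remainderRatio_zero]
    · rw [hn t ht.1 (pos_iff_ne_zero.2 h0) ht.2]; rfl
  · filter_upwards [hev, hbound] with n h1 h2 t ht htT
    refine (h1 t htT (h2 t ht htT)).trans (NNReal.coe_le_coe.2 (hmono ?_))
    exact NNReal.coe_le_coe.1 (by
      rw [coe_nnnorm, Real.coe_toNNReal _ (by positivity)]; exact h2 t ht htT)
  · intro t ht
    simp only [ht, remainderRatio_zero]
  · intro t ht htT hj
    refine (tendsto_remainderRatio_prev hΩ hF hx ht hj).congr' ?_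
    filter_upwards [hjump, π.eventually_prev_pos ht] with n h1 h2
    rw [h1 _ (prev_mem (π.zero_mem n) t) h2 ((prev_le _ _).trans htT)]
  · intro t ht htT hj s hs hsm
    have hc := hxc.continuousAt hj
    have hδ : Tendsto (fun n => incr (π.pts n) x (s n)) atTop (𝓝 0) := by
      have := (hc.tendsto.comp (π.tendsto_next hs (hsm.mono fun _ h => h.1))).sub
        (hc.tendsto.comp hs)
      rwa [sub_self] at this
    rw [Metric.tendsto_nhds]
    intro ε hε
    filter_upwards [hjump, hbound, hev, hsm, hδ.eventually (hω ε hε), hs.eventually_const_lt ht]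
      with n h1 h2 h3 h4 h5 h6
    have h7 := h3 _ h4.2 (h2 _ h4.1 h4.2)
    rw [h1 _ h4.1 h6 h4.2] at h7 ⊢
    rw [Real.dist_eq, sub_zero]
    by_cases h0 : incr (π.pts n) x (s n) = 0
    · rw [h0, remainderRatio_zero, abs_zero]; exact hε
    · exact h7.trans_lt (h5 h0)

end Remainder

/-! ### The change of variable formula -/

section Formula
variable {π : PartitionSeq} {Ω : Set (Traj m)} {F : Functional m ℝ} {x : Traj m}
  {q : ℝ≥0 → Matrix (Fin m) (Fin m) ℝ}

/-- The total second-order term, before the jumps are separated from the quadratic variation. -/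
noncomputable def hessIntegral (F : Functional m ℝ) (x : Traj m)
    (q : ℝ≥0 → Matrix (Fin m) (Fin m) ℝ) (T : ℝ≥0) : ℝ :=
  ∑ i, ∑ j, (∫ t, vertHess F t (stopLeft x t) i j ∂stieltjes (polarLimit q 1 i j) T -
    ∫ t, vertHess F t (stopLeft x t) i j ∂stieltjes (polarLimit q (-1) i j) T)

lemma tendsto_sum_hessForm (hΩ : IsGeneric π Ω) (hF : IsC12 π Ω F) (hx : x ∈ Ω)
    (hq : HasQuadVar π x q) (T : ℝ≥0) :
    Tendsto (fun n => ∑ t ∈ (π.pts n).filter (fun t => t ≤ T),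
      hessForm F (approx (π.pts n) x) t (incr (π.pts n) x t)) atTop
      (𝓝 (hessIntegral F x q T)) := by
  have := tendsto_finsetSum Finset.univ fun i _ => tendsto_finsetSum Finset.univ fun j _ =>
    tendsto_sum_hess (hF.hess_leftCts i j) (hF.hess_locallyBdd i j) hx (hΩ.cadlag x hx) hq i j T
  refine this.congr fun n => ?_
  simp only [hessForm]
  symm
  rw [Finset.sum_comm]
  exact Finset.sum_congr rfl fun i _ => Finset.sum_comm

/-- The first partition interval contributes nothing in the limit. -/
lemma tendsto_first_interval (hΩ : IsGeneric π Ω) (hF : IsC12 π Ω F) (hx : x ∈ Ω) :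
    Tendsto (fun n => inner ℝ (vertGrad F 0 (stopLeft (approx (π.pts n) x) 0))
      (incr (π.pts n) x 0) + hessForm F (approx (π.pts n) x) 0 (incr (π.pts n) x 0) / 2) atTop
      (𝓝 0) := by
  have hn := π.tendsto_next (tendsto_const_nhds (x := (0 : ℝ≥0))) (.of_forall π.zero_mem)
  have hδ : Tendsto (fun n => incr (π.pts n) x 0) atTop (𝓝 0) := by
    have := ((hΩ.cadlag x hx).tendsto_right hn (.of_forall fun n => zero_le)).sub_const (x 0)
    rwa [sub_self] at this
  have hδi : ∀ i, Tendsto (fun n => incr (π.pts n) x 0 i) atTop (𝓝 0) := fun i =>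
    ((EuclideanSpace.proj (𝕜 := ℝ) i).continuous.tendsto _).comp hδ
  have hle : ∀ᶠ n in atTop, (0 : ℝ≥0) ≤ prev (π.pts n) 0 := .of_forall fun _ => zero_le
  have h1 := tendsto_finsetSum Finset.univ fun i _ =>
    ((hF.grad_leftCts i).convergesLeft hx 0 _ tendsto_const_nhds hle).mul (hδi i)
  have h2 := tendsto_finsetSum Finset.univ fun i _ => tendsto_finsetSum Finset.univ fun j _ =>
    ((hF.hess_leftCts i j).convergesLeft hx 0 _ tendsto_const_nhds hle).mul
      ((hδi i).mul (hδi j))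
  simpa [inner_eq_sum, hessForm] using h1.add (h2.div_const 2)

/-- The Riemann sums in terms of the increments of the functional and the remainders. -/
lemma eventually_cumul_increment (T : ℝ≥0) :
    ∀ᶠ n in atTop, cumul (π.pts n) (fun t => F t (stopAt (approx (π.pts n) x) t) -
          F t (stopLeft (approx (π.pts n) x) t)) T =
      riemannSum (π.pts n) F x T
      + (∑ t ∈ (π.pts n).filter (fun t => t ≤ T),
          hessForm F (approx (π.pts n) x) t (incr (π.pts n) x t)) / 2
      + (∑ t ∈ (π.pts n).filter (fun t => t ≤ T),
          remainderRatio F (approx (π.pts n) x) t (jump (approx (π.pts n) x) t) *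
          ‖jump (approx (π.pts n) x) t‖ ^ 2)
      - (inner ℝ (vertGrad F 0 (stopLeft (approx (π.pts n) x) 0)) (incr (π.pts n) x 0)
        + hessForm F (approx (π.pts n) x) 0 (incr (π.pts n) x 0) / 2) := by
  filter_upwards [π.eventually_lt_sup T] with n hn
  set y := approx (π.pts n) x with hy
  have h0 : (0 : ℝ≥0) ∈ (π.pts n).filter (fun t => t ≤ T) :=
    Finset.mem_filter.2 ⟨π.zero_mem n, zero_le⟩
  rw [eq_sub_iff_add_eq, cumul, riemannSum, Finset.sum_div, ← Finset.sum_add_distrib,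
    ← Finset.sum_add_distrib, ← Finset.add_sum_erase _ _ h0, ← Finset.add_sum_erase _ _ h0]
  -- The approximation does not jump at time 0, whereas the Riemann and Hessian sums contain a term
  -- there. This is the correction subtracted on the right.
  have hJ0 : F 0 (stopAt y 0) - F 0 (stopLeft y 0) = 0 := by rw [stopLeft_zero, sub_self]
  rw [hJ0, jump_zero, remainderRatio_zero, zero_add, add_comm, zero_mul, add_zero]
  refine congr_arg₂ _ rfl (Finset.sum_congr rfl fun t ht => ?_)
  rw [Finset.mem_erase, Finset.mem_filter] at ht
  have hj : jump y t = incr (π.pts n) x t :=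
    jump_approx (π.zero_mem n) x ht.2.1 (pos_iff_ne_zero.2 ht.1) (ht.2.2.trans_lt hn)
  rw [remainderRatio_mul, jumpTerm, hj]
  simp only [incr]
  ring

/-- The limit of the Riemann sums. -/
theorem tendsto_riemannSum (hΩ : IsGeneric π Ω) (hF : IsC12 π Ω F) (hx : x ∈ Ω)
    (hq : HasQuadVar π x q) (T : ℝ≥0) :
    Tendsto (fun n => riemannSum (π.pts n) F x T) atTop
      (𝓝 (F T (stopAt x T) - F 0 (stopAt x 0)
        - (∫ u in (0 : ℝ)..T, horizDeriv F u.toNNReal (stopAt x u.toNNReal))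
        - hessIntegral F x q T / 2
        - ∫ t, remainderRatio F x t (jump x t) ∂stieltjes (traceLimit q) T)) := by
  have hR := hF.continuous.rightCts hΩ
  have hlim := ((((((hR.tendsto_approx hx T).sub (hR.tendsto_approx hx 0)).sub
    (tendsto_integral_approx hΩ hF.horiz_rightCts hF.horiz_locallyBdd hx T).2.2).sub
    ((tendsto_sum_hessForm hΩ hF hx hq T).div_const 2)).sub
    (tendsto_sum_remainder hΩ hF hx hq T).2).add (tendsto_first_interval hΩ hF hx))
  rw [add_zero] at hlim
  refine hlim.congr' ?_
  filter_upwards [eventually_increment_approx hΩ hF hx T,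
    eventually_cumul_increment (π := π) (F := F) (x := x) T] with n h1 h2
  rw [h1, h2]
  ring

/-- The jump terms of the change of variable formula. -/
theorem hasSum_jumpTerm (hΩ : IsGeneric π Ω) (hF : IsC12 π Ω F) (hx : x ∈ Ω)
    (hq : HasQuadVar π x q) (T : ℝ≥0) :
    HasSum (fun t : Set.Iic T => jumpTerm F x t)
      ((∫ t, remainderRatio F x t (jump x t) ∂stieltjes (traceLimit q) T)
        + (hessIntegral F x q T - ∑ i, ∑ j,
          (∫ t in {t | jump x t ≠ 0}ᶜ, vertHess F t (stopLeft x t) i j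
              ∂stieltjes (polarLimit q 1 i j) T -
            ∫ t in {t | jump x t ≠ 0}ᶜ, vertHess F t (stopLeft x t) i j
              ∂stieltjes (polarLimit q (-1) i j) T)) / 2) := by
  have hxc := hΩ.cadlag x hx
  have hA := hq.countable_jumps hxc
  have h1 := (hq.weightLimit_trace hxc).integral_eq hA (tendsto_sum_remainder hΩ hF hx hq T).1
  have h0 : ∫ t in {t | jump x t ≠ 0}ᶜ, remainderRatio F x t (jump x t)
      ∂stieltjes (traceLimit q) T = 0 := by
    -- Away from the jumps the ratio is 0, so the remainder integral is purely atomic.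
    refine setIntegral_eq_zero_of_forall_eq_zero fun t ht => ?_
    have : jump x t = 0 := by by_contra h; exact ht h
    rw [this, remainderRatio_zero]
  rw [h0, sub_zero] at h1
  have hi := fun σ i j => integrable_hess (hF.hess_leftCts i j) (hF.hess_locallyBdd i j) hx hxc hq
    σ i j T
  have h2 := hasSum_sum (s := Finset.univ) fun i _ => hasSum_sum (s := Finset.univ) fun j _ =>
    ((hq.weightLimit_polar hxc 1 i j).integral_eq hA (hi 1 i j)).sub
      ((hq.weightLimit_polar hxc (-1) i j).integral_eq hA (hi (-1) i j))
  have h3 := h1.add (h2.div_const 2)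
  convert h3 using 1
  · ext t
    rw [remainderRatio_mul]
    simp only [← mul_sub, polar_sub_polar]
    rw [hessForm]
    ring
  · rw [hessIntegral, ← Finset.sum_sub_distrib]
    simp only [← Finset.sum_sub_distrib]
    congr 3
    ext i
    congr 1
    ext j
    ring

end Formula

lemma hasQuadVar_quadVar {π : PartitionSeq} {x : Traj m} (h : ∃ q, HasQuadVar π x q) :
    HasQuadVar π x (quadVar π x) := by
  rw [quadVar, dif_pos h]
  exact h.choose_spec

end CausalCalculus

open CausalCalculus
theorem mainTheorem1 {m : ℕ} (π : PartitionSeq) (Ω : Set (Traj m)) (hΩ : IsGeneric π Ω)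
    (F : Functional m ℝ) (hF : IsC12 π Ω F) (x : Traj m) (hx : x ∈ Ω ∩ finiteQV m π) (T : ℝ≥0) :
    (∀ i j, Summable fun s : Set.Iic T => |jump x s i * jump x s j|) ∧
    IntervalIntegrable (fun u : ℝ => horizDeriv F u.toNNReal (stopAt x u.toNNReal)) volume 0 T ∧
    (Summable fun t : Set.Iic T => |jumpTerm F x t|) ∧
    ∃ (I : ℝ) (C : Matrix (Fin m) (Fin m) ℝ),
      Tendsto (fun n => riemannSum (π.pts n) F x T) atTop (𝓝 I) ∧
      (∀ i j, HasStieltjesIntegral (fun t => vertHess F t (stopLeft x t) i j)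
        (contQuadVar π x i j) T (C i j)) ∧
      F T (stopAt x T) = F 0 (stopAt x 0)
        + (∫ u in (0 : ℝ)..T, horizDeriv F u.toNNReal (stopAt x u.toNNReal))
        + I
        + (1 / 2) * (∑ i, ∑ j, C i j)
        + ∑' t : Set.Iic T, jumpTerm F x t := by
  obtain ⟨hxΩ, hxc, hex⟩ := hx
  have hq := hasQuadVar_quadVar hex
  have hJ := hasSum_jumpTerm hΩ hF hxΩ hq T
  refine ⟨fun i j => (summable_jumps hxc hq i j T).abs,
    (tendsto_integral_approx hΩ hF.horiz_rightCts hF.horiz_locallyBdd hxΩ T).1,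
    hJ.summable.abs, _, Matrix.of fun i j => _, tendsto_riemannSum hΩ hF hxΩ hq T,
    fun i j => hasStieltjesIntegral_contQuadVar hxc hq i j fun σ =>
      integrable_hess (hF.hess_leftCts i j) (hF.hess_locallyBdd i j) hxΩ hxc hq σ i j T, ?_⟩
  -- The remainder integral and the full Hessian integral occur with opposite signs in the Riemann
  -- limit and in the jump sum, whose continuous Hessian part cancels the terms C.
  rw [hJ.tsum_eq]
  simp only [Matrix.of_apply]
  ring_nf
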